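/- **Setting.** Let $\nu$ be a $\sigma$-finite measure on a measurable space and $f_0,f_1$ two probability densities with respect to $\nu$ whose Kullback–Leibler divergences $I_0=\int\log(f_0/f_1)f_0\,d\nu$ and $I_1=\int\log(f_1/f_0)f_1\,d\nu$ are positive and finite. Under $\mathsf P_i$ (expectation $\mathsf E_i$), $i\in\{0,1\}$, the observations $X_1,X_2,\dots$ are i.i.d. with density $f_i$; put $\mathcal F_n=\sigma(X_1,\dots,X_n)$, $\Lambda_n=\sum_{k=1}^n\log\frac{f_1(X_k)}{f_0(X_k)}$ and $\bar\Lambda_n=\Lambda_n/n$. A test $(T,D)$ consists of an $(\mathcal F_n)_{n\ge1}$-stopping time $T$ with values in the positive integers, finite with probability one under $\mathsf P_0$ and $\mathsf P_1$, and an $\mathcal F_T$-measurable decision $D\in\{0,1\}$. For $\alpha,\beta\in(0,1)$, $\mathcal E(\alpha,\beta)$ is the class of tests with $\mathsf P_0(D=1)\le\alpha$ and $\mathsf P_1(D=0)\le\beta$, and $\mathcal L_i(\alpha,\beta)=\inf_{(T,D)\in\mathcal E(\alpha,\beta)}\mathsf E_i[T]$. A family of tests $(T^*(\alpha,\beta),D^*(\alpha,\beta))$,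 $\alpha,\beta\in(0,1)$, is *asymptotically optimal under the null* if $(T^*(\alpha,\beta),D^*(\alpha,\beta))\in\mathcal E(\alpha,\beta)$ for all $\alpha,\beta\in(0,1)$ and $\mathsf E_0[T^*(\alpha,\beta)]\sim\mathcal L_0(\alpha,\beta)$ as $\alpha,\beta\to0$. Here and below, $\alpha,\beta\to 0$ jointly at arbitrary rates, and $x\sim y$, $x\lesssim y$, $x\ll y$, $x\gg y$ mean $\lim x/y=1$, $\limsup x/y\le1$, $\lim x/y=0$, $\lim x/y=\infty$. For $a,\delta\in(0,1)$ let $n^*(a,\delta)$ be the smallest integer $n\ge1$ for which some $c\in\mathbb R$ satisfies $\mathsf P_0(\bar\Lambda_n>c)\le a$ and $\mathsf P_1(\bar\Lambda_n\le c)\le\delta$, let $c^*(a,\delta)$ be the smallest such $c$ for $n=n^*(a,\delta)$, and put $\mathsf{FSST}(a,\delta)=(n^*(a,\delta),c^*(a,\delta))$. **The two tests.** Let $K=K(\alpha,\beta)\ge1$ be an integer. Given stage sizes $m_j$, thresholds $b_j$ and statistics $\Lambda'_j$, $1\le j\le K$, and $M_j=m_1+\dots+m_j$, $M_0=0$, the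 corresponding $K$-stage test stops after $M_j$ observations and accepts the null at the first stage $j\le K$ with $\Lambda'_j\le b_j$; if $\Lambda'_j>b_j$ for all $j\le K$, it stops after $M_K$ observations and rejects the null. Put $\delta_1=\beta-\sum_{i=2}^K(\beta/2)^i$ and $\delta_j=(\beta/2)^j$ for $2\le j\le K$. * *Sequential Thresholding* $(T',D')$: $(m_j,b_j)=\mathsf{FSST}(\alpha^{1/K},\delta_j)$ for $1\le j\le K$, and $\Lambda'_j=(\Lambda_{M_j}-\Lambda_{M_{j-1}})/m_j$. * *Modified Sequential Thresholding* $(T'',D'')$: $\Lambda'_j=\bar\Lambda_{M_j}$, $(m_1,b_1)=\mathsf{FSST}(\alpha^{1/K},\delta_1)$ and, recursively for $2\le j\le K$, $m_j$ is the smallest integer $n$ for which some $b\in\mathbb R$ satisfies $$\mathsf P_0\Big(\bar\Lambda_{M_{j-1}+n}>b,\ \bigcap_{i=1}^{j-1}\{\bar\Lambda_{M_i}>b_i\}\Big)\le\alpha^{j/K}\quad\text{and}\quad\mathsf P_1\big(\bar\Lambda_{M_{j-1}+n}\le b\big)\le(\beta/2)^j ,$$ and $b_j$ is the smallest such $b$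 for $n=m_j$ (with $b_j=-\infty$, i.e. the stage is always passed, if these $b$ are not bounded below). In the definition of $m_j$, $j\ge2$, $n$ ranges either over the positive or over the nonnegative integers; the theorem holds under either convention. **Theorem.** As $\alpha,\beta\to0$, the condition $$\alpha^{1/K}\to0\quad\text{and}\quad|\log\alpha^{1/K}|\ll|\log\beta|$$ is equivalent to $$\frac{|\log\alpha|}{|\log\beta|}\ll K\ll|\log\alpha| .$$ If it holds, then the families $(T'(\alpha,\beta),D'(\alpha,\beta))$ and $(T''(\alpha,\beta),D''(\alpha,\beta))$, $\alpha,\beta\in(0,1)$, are both asymptotically optimal under the null. Moreover, as $\alpha,\beta\to0$, $$\mathsf E_1[T'(\alpha,\beta)]\sim\frac{K(K+1)}2\,\frac{|\log\beta|}{I_0}\gg\frac{K+1}2\,\mathcal L_1(\alpha,\beta),$$ $$\mathsf E_1[T''(\alpha,\beta)]\lesssim K\,\frac{|\log\beta|}{I_0}\sim\frac{2}{K+1}\,\mathsf E_1[T'(\alpha,\beta)] .$$ -/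

import Mathlib

open MeasureTheory Filter Set
open scoped Topology ENNReal

/-! Asymptotic relations, for positive quantities, along a filter `l`. -/

/-- `x ∼ y` : `lim x / y = 1`. -/
def AsympEquiv {ι : Type*} (l : Filter ι) (x y : ι → ℝ≥0∞) : Prop :=
  Tendsto (fun a => x a / y a) l (𝓝 1)

/-- `x ≲ y` : `limsup x / y ≤ 1`. -/
def AsympLE {ι : Type*} (l : Filter ι) (x y : ι → ℝ≥0∞) : Prop :=
  limsup (fun a => x a / y a) l ≤ 1

/-- `x ≫ y` : `lim x / y = ∞`. -/
def MuchGreater {ι : Type*} (l : Filter ι) (x y : ι → ℝ≥0∞) : Prop :=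
  Tendsto (fun a => x a / y a) l (𝓝 ∞)

/-- `x ≪ y` for real-valued quantities: `lim x / y = 0`. -/
def MuchLess {ι : Type*} (l : Filter ι) (x y : ι → ℝ) : Prop :=
  Tendsto (fun a => x a / y a) l (𝓝 0)

/-- The regime `α, β → 0` (through positive values, at arbitrary rates). -/
def smallErrors : Filter (ℝ × ℝ) := 𝓝[>] (0 : ℝ) ×ˢ 𝓝[>] (0 : ℝ)

/-- Two probability densities `f 0`, `f 1` with respect to a common `σ`-finite measure `ν`,
that is, two simple hypotheses about the common density of a sequence of independent
observations. -/
structure SimpleTesting (S : Type*) [MeasurableSpace S] where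
  ν : Measure S
  sigmaFinite_ν : SigmaFinite ν
  f : Fin 2 → S → ℝ
  measurable_f : ∀ i, Measurable (f i)
  f_nonneg : ∀ i x, 0 ≤ f i x
  lintegral_f : ∀ i, ∫⁻ x, ENNReal.ofReal (f i x) ∂ν = 1

namespace SimpleTesting

variable {S : Type*} [MeasurableSpace S] (H : SimpleTesting S)

/-- The law of one observation under the hypothesis `i`. -/
noncomputable def law (i : Fin 2) : Measure S :=
  H.ν.withDensity fun x => ENNReal.ofReal (H.f i x)

instance isProbabilityMeasure_law (i : Fin 2) : IsProbabilityMeasure (H.law i) :=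
  ⟨by simp [law, withDensity_apply _ MeasurableSet.univ, H.lintegral_f i]⟩

/-- The Kullback-Leibler divergence `∫ log (f i / f (1 - i)) f i dν`, as an extended nonnegative
number (it is `∞` if the law under `i` is not absolutely continuous with respect to the other
one). -/
noncomputable def kl (i : Fin 2) : ℝ≥0∞ := InformationTheory.klDiv (H.law i) (H.law (1 - i))

/-- The real number `I_i`. -/
noncomputable def I (i : Fin 2) : ℝ := (H.kl i).toReal

/-- The distribution of the sequence of observations under the hypothesis `i`. The `n`-th
observation, `n ≥ 1`, is the coordinate `ω (n - 1)`. -/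
noncomputable def P (i : Fin 2) : Measure (ℕ → S) := Measure.infinitePi fun _ => H.law i

/-- The log-likelihood ratio `Λ_n` of the first `n` observations. -/
noncomputable def llr (n : ℕ) (ω : ℕ → S) : ℝ :=
  ∑ i ∈ Finset.range n, Real.log (H.f 1 (ω i) / H.f 0 (ω i))

/-- The average log-likelihood ratio `Λ_n / n` of the first `n` observations. -/
noncomputable def avgLlr (n : ℕ) (ω : ℕ → S) : ℝ := H.llr n ω / n

/-- The `σ`-algebra generated by the first `n` observations. -/
abbrev obs (S : Type*) [MeasurableSpace S] (n : ℕ) : MeasurableSpace (ℕ → S) :=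
  ⨆ i : Fin n, MeasurableSpace.comap (fun ω : ℕ → S => ω i) inferInstance

/-- `(T, D)` is a (sequential) test: `T` is a stopping time with values in the positive integers,
finite with probability one under both hypotheses, and `D` is a binary decision that depends only
on the observations collected up to time `T`. -/
structure IsTest (T : (ℕ → S) → ℕ∞) (D : (ℕ → S) → Fin 2) : Prop where
  one_le : ∀ ω, 1 ≤ T ω
  finite : ∀ i, ∀ᵐ ω ∂(H.P i), T ω ≠ ⊤
  stopping : ∀ n : ℕ, 1 ≤ n → MeasurableSet[obs S n] {ω | T ω = n}
  measurable_decision : Measurable D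
  decision : ∀ n : ℕ, 1 ≤ n → ∀ i : Fin 2, MeasurableSet[obs S n] {ω | T ω = n ∧ D ω = i}

/-- The class `𝓔(α, β)` of tests with error probabilities at most `α` and `β`. -/
def testClass (α β : ℝ) : Set (((ℕ → S) → ℕ∞) × ((ℕ → S) → Fin 2)) :=
  {χ | H.IsTest χ.1 χ.2 ∧
    (H.P 0).real {ω | χ.2 ω = 1} ≤ α ∧ (H.P 1).real {ω | χ.2 ω = 0} ≤ β}

/-- The expected sample size `E_i[T]`. -/
noncomputable def ess (i : Fin 2) (T : (ℕ → S) → ℕ∞) : ℝ≥0∞ :=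
  ∫⁻ ω, (T ω : ℝ≥0∞) ∂(H.P i)

/-- The optimal expected sample size `𝓛_i(α, β)` under hypothesis `i`. -/
noncomputable def optEss (i : Fin 2) (α β : ℝ) : ℝ≥0∞ :=
  ⨅ χ ∈ H.testClass α β, H.ess i χ.1

/-- Asymptotic optimality under the null hypothesis of a family of tests indexed by `(α, β)`. -/
def AsympOptimalNull (χ : ℝ → ℝ → ((ℕ → S) → ℕ∞) × ((ℕ → S) → Fin 2)) : Prop :=
  (∀ α ∈ Ioo (0 : ℝ) 1, ∀ β ∈ Ioo (0 : ℝ) 1, χ α β ∈ H.testClass α β) ∧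
  AsympEquiv smallErrors (fun p => H.ess 0 (χ p.1 p.2).1) (fun p => H.optEss 0 p.1 p.2)

/-! ### The fixed-sample-size test -/

/-- The smallest sample size `n^*(α, β)`. -/
noncomputable def nStar (α β : ℝ) : ℕ :=
  sInf {n : ℕ | 1 ≤ n ∧ ∃ c : ℝ, (H.P 0).real {ω | c < H.avgLlr n ω} ≤ α ∧
    (H.P 1).real {ω | H.avgLlr n ω ≤ c} ≤ β}

/-- The smallest threshold `c^*(α, β)` for the sample size `n^*(α, β)`. -/
noncomputable def cStar (α β : ℝ) : ℝ :=
  sInf {c : ℝ | (H.P 0).real {ω | c < H.avgLlr (H.nStar α β) ω} ≤ α ∧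
    (H.P 1).real {ω | H.avgLlr (H.nStar α β) ω ≤ c} ≤ β}

/-! ### Multistage tests that can reject only at the last stage -/

/-- The stage at which the test with at most `K` stages, statistics `stat j` and thresholds `b j`
(`j = 1, …, K`) stops: the first `j` with `stat j ≤ b j`, or `K` if there is none before. -/
noncomputable def lastStage (K : ℕ) (stat : ℕ → (ℕ → S) → ℝ) (b : ℕ → EReal) (ω : ℕ → S) : ℕ :=
  sInf {j : ℕ | 1 ≤ j ∧ (j = K ∨ (stat j ω : EReal) ≤ b j)}

open Classical in
/-- The test (sample size and decision) with at most `K` stages, the `j`-th of which ends after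
`M j` observations in total: accept the null at the first stage `j` with `stat j ≤ b j`, and
reject it if `stat j > b j` for every `j = 1, …, K`. -/
noncomputable def stagedTest (K : ℕ) (M : ℕ → ℕ) (stat : ℕ → (ℕ → S) → ℝ) (b : ℕ → EReal) :
    ((ℕ → S) → ℕ∞) × ((ℕ → S) → Fin 2) :=
  (fun ω => (M (lastStage K stat b ω) : ℕ∞),
   fun ω => if ∀ j ∈ Finset.Icc 1 K, b j < (stat j ω : EReal) then 1 else 0)

/-- The type-II error probability allotted to stage `j` (`j = 1, …, K`). -/
noncomputable def typeIILevel (β : ℝ) (K j : ℕ) : ℝ :=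
  if j = 1 then β - ∑ i ∈ Finset.Icc 2 K, (β / 2) ^ i else (β / 2) ^ j

/-! ### Sequential Thresholding -/

/-- The size `m_j` of stage `j` of ST. -/
noncomputable def stSize (α β : ℝ) (K j : ℕ) : ℕ :=
  H.nStar (α ^ (1 / (K : ℝ))) (typeIILevel β K j)

/-- The threshold `b_j` of stage `j` of ST. -/
noncomputable def stThreshold (α β : ℝ) (K j : ℕ) : ℝ :=
  H.cStar (α ^ (1 / (K : ℝ))) (typeIILevel β K j)

/-- The total number `M_j = m_1 + ⋯ + m_j` of observations in the first `j` stages of ST. -/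
noncomputable def stTotal (α β : ℝ) (K j : ℕ) : ℕ := ∑ i ∈ Finset.Icc 1 j, H.stSize α β K i

/-- The statistic of stage `j` of ST: the average log-likelihood ratio of the observations
collected during stage `j` only. -/
noncomputable def stStat (α β : ℝ) (K j : ℕ) (ω : ℕ → S) : ℝ :=
  (H.llr (H.stTotal α β K j) ω - H.llr (H.stTotal α β K (j - 1)) ω) / H.stSize α β K j

/-- Sequential Thresholding with at most `K` stages. -/
noncomputable def ST (α β : ℝ) (K : ℕ) : ((ℕ → S) → ℕ∞) × ((ℕ → S) → Fin 2) :=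
  stagedTest K (H.stTotal α β K) (H.stStat α β K) (fun j => (H.stThreshold α β K j : EReal))

/-! ### Modified Sequential Thresholding -/

/-- The data of mod-ST after some stage `j`: the total number `M_j` of observations so far, the
threshold `b_j`, and the event that the threshold has been exceeded at all stages `1, …, j`. -/
structure ModStage (S : Type*) where
  total : ℕ
  threshold : EReal
  passed : Set (ℕ → S)

/-- The real thresholds `b` that satisfy both error constraints, with levels `a` and `δ`, for a
stage after which `N` observations have been collected in total, when `A` is the event that all
previous thresholds have been exceeded. -/
def modThresholds (A : Set (ℕ → S)) (N : ℕ) (a δ : ℝ) : Set ℝ :=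
  {b : ℝ | (H.P 0).real ({ω | b < H.avgLlr N ω} ∩ A) ≤ a ∧
    (H.P 1).real {ω | H.avgLlr N ω ≤ b} ≤ δ}

/-- The smallest stage size, at least `r`, for which some threshold satisfies both constraints. -/
noncomputable def modSize (r : ℕ) (s : ModStage S) (a δ : ℝ) : ℕ :=
  sInf {n : ℕ | r ≤ n ∧ (H.modThresholds s.passed (s.total + n) a δ).Nonempty}

/-- The stage that follows `s`. Its threshold is the smallest one that satisfies both constraints;
if arbitrarily small thresholds do (which happens when the event of having passed the previous
stages has probability at most `a` under the null already), it is `-∞`, so that the stage is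
always passed. -/
noncomputable def modNext (r : ℕ) (s : ModStage S) (a δ : ℝ) : ModStage S :=
  let N := s.total + H.modSize r s a δ
  let b : EReal := sInf ((fun b : ℝ => (b : EReal)) '' H.modThresholds s.passed N a δ)
  { total := N
    threshold := b
    passed := s.passed ∩ {ω | b < (H.avgLlr N ω : EReal)} }

/-- The stages of mod-ST: the first is that of ST, and the later ones, of size at least `r`, are
specified recursively. (The value at `0` is the situation before the first stage.) -/
noncomputable def modStage (r : ℕ) (α β : ℝ) (K : ℕ) : ℕ → ModStage S
  | 0 => { total := 0, threshold := ⊥, passed := univ }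
  | 1 =>
    { total := H.stSize α β K 1
      threshold := (H.stThreshold α β K 1 : EReal)
      passed := {ω | H.stThreshold α β K 1 < H.avgLlr (H.stSize α β K 1) ω} }
  | j + 2 =>
    H.modNext r (modStage r α β K (j + 1)) (α ^ (((j + 2 : ℕ) : ℝ) / (K : ℝ)))
      (typeIILevel β K (j + 2))

/-- Modified Sequential Thresholding with at most `K` stages (later stages of size at least `r`):
the statistic of stage `j` is the average log-likelihood ratio of all observations collected up to
the end of stage `j`. -/
noncomputable def modST (r : ℕ) (α β : ℝ) (K : ℕ) : ((ℕ → S) → ℕ∞) × ((ℕ → S) → Fin 2) :=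
  stagedTest K (fun j => (H.modStage r α β K j).total)
    (fun j => H.avgLlr (H.modStage r α β K j).total)
    (fun j => (H.modStage r α β K j).threshold)

end SimpleTesting

namespace SimpleTesting
variable {S : Type*} [MeasurableSpace S] (H : SimpleTesting S)

/-! ### Events that depend on finitely many observations -/

/-! Type-II errors dictate the stage sizes, while type-I errors come almost for free. Fix a
threshold `-κ` with `κ < I 0`. By Markov, `P 1` puts mass at most `exp (-κ n)` on averages below it;
by Chernoff, `P 0` puts exponentially small mass, at some rate `ρ > 0`, on averages above it
(`exists_errors_le`). At stage `j` the levels can be taken as `a ^ j`, with `a = α ^ (1 / K)`, and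
`(β / 2) ^ j`. Both logarithms are linear in `j`, so if `|log a| ≪ |log β|`, a single `B` close to
`|log β| / I 0` makes every sample size `N ≥ j B` sufficient at stage `j`, uniformly in `j`
(`eventually_sizeSuffices`). Hence `M_j` is at most about `B j (j + 1) / 2` for ST and `B j` for
mod-ST. Under the null, `j` stages are passed with probability at most `a ^ j`: by independence of
the blocks for ST, by construction for mod-ST. As `a → 0`, only the first stage contributes to the
mean, which is asymptotically at most `|log β| / I 0`. The matching lower bounds come from Stein's
converse `exists_P_zero_le`, obtained by a change of measure and the law of large numbers: an event
with `P 1`-probability at most `δ`, determined by fewer than `(1 - ε) |log δ| / I 0` observations,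
has small `P 0`-probability. Applied to accepting by time `N`, it bounds `optEss 0`; applied to each
stage of ST, it bounds `M_K`, which is the sample size of ST with `P 1`-probability at least `1 -
β`. For the comparison with `optEss 1`, a two-stage test that can reject early costs `O(1 + |log
α|)` plus `α` times `O(1 + |log α| + |log β|)`, which is `≪ K |log β|` (`exists_optEss_one_le`). The
two forms of the condition agree because `|log a| = |log α| / K`. -/

lemma obs_le (n : ℕ) : obs S n ≤ MeasurableSpace.pi :=
  iSup_le fun i => (measurable_pi_apply (i : ℕ)).comap_le

lemma obs_mono : Monotone (obs S) := by
  intro m n h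
  refine iSup_le fun i => ?_
  exact le_iSup (fun j : Fin n => MeasurableSpace.comap (fun ω : ℕ → S => ω j) inferInstance)
    (Fin.castLE h i)

lemma measurable_obs_apply {n i : ℕ} (hi : i < n) :
    Measurable[obs S n] fun ω : ℕ → S => ω i := by
  refine Measurable.of_comap_le ?_
  exact le_iSup (fun j : Fin n => MeasurableSpace.comap (fun ω : ℕ → S => ω j) inferInstance)
    ⟨i, hi⟩

lemma exists_preimage_restrict {n : ℕ} {A : Set (ℕ → S)} (hA : MeasurableSet[obs S n] A) :
    ∃ B : Set (Finset.range n → S), MeasurableSet B ∧ (Finset.range n).restrict ⁻¹' B = A := by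
  have h : obs S n ≤ MeasurableSpace.comap ((Finset.range n).restrict (π := fun _ : ℕ => S))
      MeasurableSpace.pi := by
    refine iSup_le fun i => ?_
    rintro _ ⟨t, ht, rfl⟩
    exact ⟨(fun x => x ⟨i, Finset.mem_range.2 i.2⟩) ⁻¹' t, measurable_pi_apply _ ht, rfl⟩
  exact h A hA

lemma mem_congr_of_obs {n : ℕ} {A : Set (ℕ → S)} (hA : MeasurableSet[obs S n] A)
    {ω ω' : ℕ → S} (h : ∀ i < n, ω i = ω' i) : ω ∈ A ↔ ω' ∈ A := by
  obtain ⟨B, -, rfl⟩ := exists_preimage_restrict hA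
  have : (Finset.range n).restrict ω = (Finset.range n).restrict ω' := by
    ext i
    exact h i (Finset.mem_range.1 i.2)
  simp only [mem_preimage, this]

/-- The sequence that starts as `p.1` until time `n` and continues as `p.2`. -/
def splice (n : ℕ) (p : (ℕ → S) × (ℕ → S)) (i : ℕ) : S := if i < n then p.1 i else p.2 (i - n)

lemma measurable_splice (n : ℕ) : Measurable (splice (S := S) n) := by
  refine measurable_pi_lambda _ fun i => ?_
  unfold splice
  split_ifs <;> fun_prop

/-- Product measures are determined by finite boxes, and the preimage of a box under splicing is a
product of two boxes, one for indices below `n` and one for the others shifted by `n`. -/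
lemma map_splice (μ : Measure S) [IsProbabilityMeasure μ] (n : ℕ) :
    ((Measure.infinitePi fun _ : ℕ => μ).prod (Measure.infinitePi fun _ : ℕ => μ)).map (splice n)
      = Measure.infinitePi fun _ => μ := by
  classical
  refine Measure.eq_infinitePi _ fun s t ht => ?_
  rw [Measure.map_apply (measurable_splice n) (.pi s.countable_toSet fun i _ => ht i)]
  have hset : splice n ⁻¹' (s : Set ℕ).pi t =
      (((s.filter (· < n) : Finset ℕ) : Set ℕ).pi t) ×ˢ
      ((((s.filter (¬ · < n)).image (· - n) : Finset ℕ) : Set ℕ).pi fun i => t (i + n)) := by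
    ext p
    simp only [mem_preimage, Set.mem_pi, Finset.mem_coe, mem_prod, Finset.mem_filter,
      Finset.mem_image, splice]
    constructor
    · intro h
      refine ⟨fun i hi => by simpa [hi.2] using h i hi.1, ?_⟩
      rintro _ ⟨i, hi, rfl⟩
      have := h i hi.1
      rw [if_neg hi.2] at this
      rwa [Nat.sub_add_cancel (not_lt.1 hi.2)]
    · rintro ⟨h1, h2⟩ i hi
      split_ifs with hin
      · exact h1 i ⟨hi, hin⟩
      · have := h2 (i - n) ⟨i, ⟨hi, hin⟩, rfl⟩
        rwa [Nat.sub_add_cancel (not_lt.1 hin)] at this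
  rw [hset, Measure.prod_prod, Measure.infinitePi_pi _ fun i _ => ht i,
    Measure.infinitePi_pi _ fun i _ => ht _, Finset.prod_image,
    ← Finset.prod_filter_mul_prod_filter_not s (· < n)]
  · congr 1
    refine Finset.prod_congr rfl fun i hi => ?_
    rw [Nat.sub_add_cancel (not_lt.1 (Finset.mem_filter.1 hi).2)]
  · intro i hi j hj hij
    have h1 := (Finset.mem_filter.1 hi).2
    have h2 := (Finset.mem_filter.1 hj).2
    simp only at hij
    omega

instance isProbabilityMeasure_P (i : Fin 2) : IsProbabilityMeasure (H.P i) := by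
  unfold P; infer_instance

/-- Independence of past and future: when the sequence is spliced from two independent copies, the
event becomes a rectangle. This is what factorizes the stages of ST. -/
lemma P_inter_shift (i : Fin 2) {n : ℕ} {A B : Set (ℕ → S)} (hA : MeasurableSet[obs S n] A)
    (hB : MeasurableSet B) :
    H.P i (A ∩ (fun ω k => ω (n + k)) ⁻¹' B) = H.P i A * H.P i B := by
  have hs : Measurable fun (ω : ℕ → S) k => ω (n + k) := by fun_prop
  conv_lhs => rw [P, ← map_splice (H.law i) n]
  rw [Measure.map_apply (measurable_splice n) ((obs_le n A hA).inter (hs hB))]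
  have : splice n ⁻¹' (A ∩ (fun ω k => ω (n + k)) ⁻¹' B) = A ×ˢ B := by
    ext p
    have h1 : splice n p ∈ A ↔ p.1 ∈ A :=
      mem_congr_of_obs hA fun k hk => by simp [splice, hk]
    have h2 : (fun k => splice n p (n + k)) = p.2 := by ext k; simp [splice]
    simp [h1, h2]
  rw [this, Measure.prod_prod, P]

lemma measurable_logRatio : Measurable fun x => Real.log (H.f 1 x / H.f 0 x) :=
  ((H.measurable_f 1).div (H.measurable_f 0)).log

lemma measurable_llr_obs (n : ℕ) : Measurable[obs S n] (H.llr n) := by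
  unfold llr
  exact Finset.measurable_fun_sum _ fun i hi =>
    H.measurable_logRatio.comp (measurable_obs_apply (Finset.mem_range.1 hi))

lemma measurable_avgLlr_obs (n : ℕ) : Measurable[obs S n] (H.avgLlr n) := by
  unfold avgLlr
  exact (H.measurable_llr_obs n).div_const _

lemma measurable_avgLlr (n : ℕ) : Measurable (H.avgLlr n) :=
  (H.measurable_avgLlr_obs n).mono (obs_le n) le_rfl

lemma llr_add (m n : ℕ) (ω : ℕ → S) :
    H.llr (m + n) ω = H.llr m ω + H.llr n fun k => ω (m + k) := by
  simp [llr, Finset.sum_range_add]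

/-! ### Likelihood ratios and change of measure -/

/-- Infinite products are usually mutually singular, so the density exists only on the first `n`
coordinates. Weighting the product of `μ'` by it gives the product measure with marginals `μ` before
`n` and `μ'` afterwards, which agrees with the product of `μ` on events of the first `n`
observations. -/
lemma infinitePi_withDensity_apply {μ μ' : Measure S} [IsProbabilityMeasure μ]
    [IsProbabilityMeasure μ'] {g : S → ℝ≥0∞} (hg : Measurable g) (hμ : μ = μ'.withDensity g)
    {n : ℕ} {A : Set (ℕ → S)} (hA : MeasurableSet[obs S n] A) :
    Measure.infinitePi (fun _ : ℕ => μ) A =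
      ∫⁻ ω in A, ∏ i ∈ Finset.range n, g (ω i) ∂Measure.infinitePi fun _ : ℕ => μ' := by
  classical
  set w : (ℕ → S) → ℝ≥0∞ := fun ω => ∏ i ∈ Finset.range n, g (ω i) with hw
  have hwm : Measurable w := by fun_prop
  let m : ℕ → Measure S := fun i => if i < n then μ else μ'
  have hm (i : ℕ) : IsProbabilityMeasure (m i) := by
    by_cases h : i < n <;> simp only [m, h, if_true, if_false] <;> infer_instance
  have key : (Measure.infinitePi fun _ : ℕ => μ').withDensity w = Measure.infinitePi m := by
    refine Measure.eq_infinitePi _ fun s t ht => ?_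
    have hst : MeasurableSet ((s : Set ℕ).pi t) := .pi s.countable_toSet fun i _ => ht i
    rw [withDensity_apply _ hst, ← lintegral_indicator hst]
    -- Box constraint and density factor of one coordinate combined, so that the integrand is a
    -- product of independent one-coordinate factors.
    let X : ℕ → S → ℝ≥0∞ := fun i x =>
      (if i ∈ s then (t i).indicator 1 x else 1) * (if i < n then g x else 1)
    have hX (i : ℕ) : Measurable (X i) := by
      refine Measurable.mul ?_ ?_
      · split_ifs
        · exact measurable_one.indicator (ht i)
        · exact measurable_const
      · split_ifs <;> fun_prop
    have hprod (ω : ℕ → S) : ((s : Set ℕ).pi t).indicator w ω =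
        ∏ i ∈ s ∪ Finset.range n, X i (ω i) := by
      have h1 : ∏ i ∈ s ∪ Finset.range n, (if i < n then g (ω i) else 1) = w ω := by
        rw [hw, ← Finset.prod_subset Finset.subset_union_right]
        · exact Finset.prod_congr rfl fun i hi => by rw [if_pos (Finset.mem_range.1 hi)]
        · intro i _ hi
          rw [if_neg (by simpa using hi)]
      have h2 : ∏ i ∈ s ∪ Finset.range n, (if i ∈ s then (t i).indicator 1 (ω i) else 1) =
          ((s : Set ℕ).pi t).indicator (1 : (ℕ → S) → ℝ≥0∞) ω := by
        rw [← Finset.prod_subset (Finset.subset_union_left (s₁ := s))]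
        · by_cases h : ω ∈ (s : Set ℕ).pi t
          · rw [indicator_of_mem h, Pi.one_apply]
            refine Finset.prod_eq_one fun i hi => ?_
            rw [if_pos hi, indicator_of_mem (h i hi), Pi.one_apply]
          · rw [indicator_of_notMem h]
            simp only [Set.mem_pi, not_forall] at h
            obtain ⟨i, hi, hit⟩ := h
            refine Finset.prod_eq_zero hi ?_
            rw [if_pos (Finset.mem_coe.1 hi), indicator_of_notMem hit]
        · intro i _ hi
          rw [if_neg hi]
      simp only [X]
      rw [Finset.prod_mul_distrib, h1, h2]
      by_cases h : ω ∈ (s : Set ℕ).pi t <;> simp [h]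
    simp_rw [hprod]
    rw [ProbabilityTheory.lintegral_prod_eq_prod_lintegral_of_indepFun _
      (fun i (ω : ℕ → S) => X i (ω i)) (ProbabilityTheory.iIndepFun_infinitePi hX)
      fun i => (hX i).comp (measurable_pi_apply i)]
    have hcoord (i : ℕ) : ∫⁻ ω, X i (ω i) ∂(Measure.infinitePi fun _ : ℕ => μ') =
        if i ∈ s then m i (t i) else 1 := by
      rw [← lintegral_map (hX i) (measurable_pi_apply i), Measure.infinitePi_map_eval]
      simp only [X, m]
      by_cases his : i ∈ s <;> by_cases hin : i < n <;> simp only [his, hin, if_true, if_false]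
      · have : ∀ x, (t i).indicator 1 x * g x = (t i).indicator g x := fun x => by
          by_cases hx : x ∈ t i <;> simp [hx]
        simp_rw [this]
        rw [lintegral_indicator (ht i), hμ, withDensity_apply _ (ht i)]
      · simp only [mul_one]
        rw [lintegral_indicator_one (ht i)]
      · simp only [one_mul]
        rw [← setLIntegral_univ, ← withDensity_apply _ .univ, ← hμ, measure_univ]
      · simp
    simp_rw [hcoord]
    rw [← Finset.prod_subset (Finset.subset_union_left (s₁ := s))]
    · exact Finset.prod_congr rfl fun i hi => by rw [if_pos hi]
    · intro i _ hi
      rw [if_neg hi]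
  rw [← withDensity_apply _ (obs_le n A hA), key]
  obtain ⟨B, hB, rfl⟩ := exists_preimage_restrict hA
  rw [← Measure.map_apply (Finset.measurable_restrict _) hB,
    ← Measure.map_apply (Finset.measurable_restrict _) hB, Measure.infinitePi_map_restrict,
    Measure.infinitePi_map_restrict]
  congr 2
  ext1 i
  simp [m, Finset.mem_range.1 i.2]

lemma ae_pos (i : Fin 2) : ∀ᵐ x ∂(H.law i), 0 < H.f i x := by
  rw [law, ae_withDensity_iff (H.measurable_f i).ennreal_ofReal]
  exact .of_forall fun x hx => by simpa using hx

lemma law_eq_withDensity {i j : Fin 2} (h : H.law i ≪ H.law j) :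
    H.law i = (H.law j).withDensity fun x => ENNReal.ofReal (H.f i x / H.f j x) := by
  have hi := H.measurable_f i
  have hj := H.measurable_f j
  have hpos : ∀ᵐ x ∂(H.law i), 0 < H.f j x := h.ae_le (H.ae_pos j)
  rw [law, ae_withDensity_iff hi.ennreal_ofReal] at hpos
  conv_rhs => rw [law]
  rw [← withDensity_mul _ (by fun_prop) (by fun_prop), law]
  refine withDensity_congr_ae ?_
  filter_upwards [hpos] with x hx
  rw [Pi.mul_apply, ← ENNReal.ofReal_mul (H.f_nonneg j x)]
  by_cases hfi : H.f i x = 0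
  · simp [hfi]
  · have hi0 : 0 < H.f i x := lt_of_le_of_ne (H.f_nonneg i x) (Ne.symm hfi)
    rw [mul_div_cancel₀ _ (hx (by simpa using hi0)).ne']

/-- The two laws are mutually absolutely continuous, and the log-likelihood ratio is integrable
under the null. -/
structure Regular : Prop where
  ac01 : H.law 0 ≪ H.law 1
  ac10 : H.law 1 ≪ H.law 0
  integrable : Integrable (fun x => Real.log (H.f 1 x / H.f 0 x)) (H.law 0)
  integral_eq : ∫ x, Real.log (H.f 1 x / H.f 0 x) ∂(H.law 0) = -H.I 0
  I_pos : 0 < H.I 0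

variable {H}

/-- The exponential form turns products of densities into `exp (-llr)`. It is legitimate since both
densities are almost everywhere positive under `law 1`. -/
lemma law_zero_eq (ac01 : H.law 0 ≪ H.law 1) (ac10 : H.law 1 ≪ H.law 0) :
    H.law 0 = (H.law 1).withDensity
      fun x => ENNReal.ofReal (Real.exp (-Real.log (H.f 1 x / H.f 0 x))) := by
  rw [H.law_eq_withDensity ac01]
  refine withDensity_congr_ae ?_
  filter_upwards [H.ae_pos 1, ac10.ae_le (H.ae_pos 0)] with x h1 h0
  rw [Real.exp_neg, Real.exp_log (div_pos h1 h0), inv_div]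

lemma law_one_eq (ac01 : H.law 0 ≪ H.law 1) (ac10 : H.law 1 ≪ H.law 0) :
    H.law 1 = (H.law 0).withDensity
      fun x => ENNReal.ofReal (Real.exp (Real.log (H.f 1 x / H.f 0 x))) := by
  rw [H.law_eq_withDensity ac10]
  refine withDensity_congr_ae ?_
  filter_upwards [H.ae_pos 0, ac01.ae_le (H.ae_pos 1)] with x h0 h1
  rw [Real.exp_log (div_pos h1 h0)]

lemma regular_of_kl (hI0 : 0 < H.kl 0 ∧ H.kl 0 < ∞) (hI1 : H.kl 1 < ∞) : H.Regular := by
  obtain ⟨ac01, hint⟩ := InformationTheory.klDiv_ne_top_iff.1 hI0.2.ne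
  obtain ⟨ac10, -⟩ := InformationTheory.klDiv_ne_top_iff.1 hI1.ne
  rw [sub_zero] at ac01 hint
  rw [sub_self] at ac10
  have hZ := H.measurable_logRatio
  -- `klDiv` is defined through a Radon–Nikodym derivative; this identifies it with the explicit
  -- ratio of densities.
  have hllr : MeasureTheory.llr (H.law 0) (H.law 1) =ᵐ[H.law 0]
      fun x => -Real.log (H.f 1 x / H.f 0 x) := by
    have := ac01.ae_le (Measure.rnDeriv_withDensity (H.law 1) (f := fun x =>
      ENNReal.ofReal (Real.exp (-Real.log (H.f 1 x / H.f 0 x)))) (by fun_prop))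
    rw [← law_zero_eq ac01 ac10] at this
    filter_upwards [this] with x hx
    rw [MeasureTheory.llr, hx, ENNReal.toReal_ofReal (Real.exp_nonneg _), Real.log_exp]
  have hint' : Integrable (fun x => -Real.log (H.f 1 x / H.f 0 x)) (H.law 0) := hint.congr hllr
  refine ⟨ac01, ac10, by simpa using hint'.neg, ?_, ENNReal.toReal_pos hI0.1.ne' hI0.2.ne⟩
  have : H.I 0 = ∫ x, -Real.log (H.f 1 x / H.f 0 x) ∂(H.law 0) := by
    rw [I, kl, sub_zero, InformationTheory.toReal_klDiv_of_measure_eq ac01 (by simp)]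
    exact integral_congr_ae hllr
  rw [this, integral_neg, neg_neg]

/-- Change of measure on events determined by the first `n` observations. -/
lemma P_zero_inter_le (hH : H.Regular) {n : ℕ} {A : Set (ℕ → S)} (hA : MeasurableSet[obs S n] A)
    (t : ℝ) :
    (H.P 0).real (A ∩ {ω | -t ≤ H.llr n ω}) ≤ Real.exp t * (H.P 1).real A := by
  have hZ := H.measurable_logRatio
  have hB : MeasurableSet[obs S n] {ω | -t ≤ H.llr n ω} :=
    H.measurable_llr_obs n measurableSet_Ici
  have key : H.P 0 (A ∩ {ω | -t ≤ H.llr n ω}) ≤ ENNReal.ofReal (Real.exp t) * H.P 1 A := by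
    rw [P, infinitePi_withDensity_apply (by fun_prop) (law_zero_eq hH.ac01 hH.ac10)
      (MeasurableSet.inter hA hB)]
    calc _ ≤ ∫⁻ ω in A ∩ {ω | -t ≤ H.llr n ω}, ENNReal.ofReal (Real.exp t) ∂(H.P 1) := by
          refine setLIntegral_mono measurable_const fun ω hω => ?_
          rw [← ENNReal.ofReal_prod_of_nonneg fun _ _ => Real.exp_nonneg _, ← Real.exp_sum]
          refine ENNReal.ofReal_le_ofReal (Real.exp_le_exp.2 ?_)
          have := hω.2
          simp only [mem_ofPred_eq, llr] at this
          rw [Finset.sum_neg_distrib]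
          linarith
      _ = ENNReal.ofReal (Real.exp t) * H.P 1 (A ∩ {ω | -t ≤ H.llr n ω}) := by
          rw [setLIntegral_const]
      _ ≤ _ := by gcongr; exact inter_subset_left
  rw [Measure.real, Measure.real, ← ENNReal.toReal_ofReal (Real.exp_nonneg t),
    ← ENNReal.toReal_mul]
  exact ENNReal.toReal_mono (ENNReal.mul_ne_top (by simp) (by finiteness)) key

/-! ### Tail bounds for the log-likelihood ratio -/

lemma map_coord (H : SimpleTesting S) (i : Fin 2) (k : ℕ) :
    (H.P i).map (fun ω => ω k) = H.law i :=
  Measure.infinitePi_map_eval _ k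

lemma integral_coord (H : SimpleTesting S) (i : Fin 2) (k : ℕ) {g : S → ℝ} (hg : Measurable g) :
    ∫ ω, g (ω k) ∂(H.P i) = ∫ x, g x ∂(H.law i) := by
  have hk : Measurable fun ω : ℕ → S => ω k := measurable_pi_apply k
  rw [← H.map_coord i k, integral_map hk.aemeasurable hg.aestronglyMeasurable]

/-- Chernoff's bound with parameter `1`; other parameters and thresholds are absorbed into `g`. -/
lemma P_sum_nonneg_le (H : SimpleTesting S) (i : Fin 2) {g : S → ℝ} (hg : Measurable g)
    (hint : Integrable (fun x => Real.exp (g x)) (H.law i)) (n : ℕ) :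
    (H.P i).real {ω | 0 ≤ ∑ k ∈ Finset.range n, g (ω k)} ≤
      (∫ x, Real.exp (g x) ∂(H.law i)) ^ n := by
  have hind : ProbabilityTheory.iIndepFun (fun (k : ℕ) (ω : ℕ → S) => g (ω k)) (H.P i) :=
    ProbabilityTheory.iIndepFun_infinitePi fun _ => hg
  have hmeas (k : ℕ) : Measurable fun ω : ℕ → S => g (ω k) := by fun_prop
  have hint' (k : ℕ) : Integrable (fun ω : ℕ → S => Real.exp (1 * g (ω k))) (H.P i) := by
    simp only [one_mul]
    rw [← H.map_coord i k] at hint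
    exact hint.comp_measurable (measurable_pi_apply k)
  have hsum := hind.integrable_exp_mul_sum hmeas (s := Finset.range n) (t := 1) fun k _ => hint' k
  have h := ProbabilityTheory.measure_ge_le_exp_mul_mgf 0 zero_le_one hsum
  rw [hind.mgf_sum hmeas] at h
  have hmgf (k : ℕ) : ProbabilityTheory.mgf (fun ω : ℕ → S => g (ω k)) (H.P i) 1 =
      ∫ x, Real.exp (g x) ∂(H.law i) := by
    simp only [ProbabilityTheory.mgf, one_mul]
    exact H.integral_coord i k hg.exp
  simp only [hmgf, Finset.prod_const, Finset.card_range] at h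
  simpa [Finset.sum_apply] using h

lemma integrable_and_integral_of_lintegral {μ : Measure S} {g : S → ℝ} (hg : Measurable g)
    (hg0 : ∀ x, 0 ≤ g x) (h : ∫⁻ x, ENNReal.ofReal (g x) ∂μ = 1) :
    Integrable g μ ∧ ∫ x, g x ∂μ = 1 := by
  refine ⟨⟨by fun_prop, ?_⟩, ?_⟩
  · rw [hasFiniteIntegral_iff_ofReal (.of_forall hg0), h]
    exact ENNReal.one_lt_top
  · rw [integral_eq_lintegral_of_nonneg_ae (.of_forall hg0) (by fun_prop), h, ENNReal.toReal_one]

/-- Markov's inequality for `exp (-llr)`, whose `P 1`-mean is one. -/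
lemma P_one_avgLlr_le (hH : H.Regular) (n : ℕ) (c : ℝ) :
    (H.P 1).real {ω | H.avgLlr n ω ≤ c} ≤ Real.exp (c * n) := by
  rcases Nat.eq_zero_or_pos n with rfl | hn
  · simp
  have hZ := H.measurable_logRatio
  obtain ⟨hint, hval⟩ := integrable_and_integral_of_lintegral (μ := H.law 1)
    (g := fun x => Real.exp (-Real.log (H.f 1 x / H.f 0 x))) (by fun_prop)
    (fun _ => Real.exp_nonneg _) (by
      rw [← setLIntegral_univ, ← withDensity_apply _ .univ, ← law_zero_eq hH.ac01 hH.ac10,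
        measure_univ])
  have hexp (x : S) : Real.exp (c - Real.log (H.f 1 x / H.f 0 x)) =
      Real.exp c * Real.exp (-Real.log (H.f 1 x / H.f 0 x)) := by
    rw [← Real.exp_add, sub_eq_add_neg]
  have h := H.P_sum_nonneg_le 1 (g := fun x => c - Real.log (H.f 1 x / H.f 0 x)) (by fun_prop)
    (by simp only [hexp]; exact hint.const_mul _) n
  simp only [hexp, integral_const_mul, hval, mul_one, ← Real.exp_nat_mul] at h
  rw [mul_comm c]
  refine le_trans (measureReal_mono fun ω hω => ?_) h
  have hω' : H.llr n ω ≤ c * n := by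
    rwa [mem_ofPred_eq, avgLlr, div_le_iff₀ (by positivity)] at hω
  simp only [mem_ofPred_eq, Finset.sum_sub_distrib, Finset.sum_const, Finset.card_range,
    nsmul_eq_mul]
  rw [llr] at hω'
  linarith

/-- The right derivative at `0` of `s ↦ ∫ exp (s Y)` is `∫ Y < 0`. Differentiation under the
integral is justified by dominated convergence, since convexity traps the difference quotients
between `Y` and `exp Y`. -/
lemma exists_integral_exp_lt_one {μ : Measure S} [IsProbabilityMeasure μ] {Y : S → ℝ}
    (hYm : Measurable Y) (hY : Integrable Y μ) (hexp : Integrable (fun x => Real.exp (Y x)) μ)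
    (hneg : ∫ x, Y x ∂μ < 0) :
    ∃ s > 0, Integrable (fun x => Real.exp (s * Y x)) μ ∧ ∫ x, Real.exp (s * Y x) ∂μ < 1 := by
  have hconv : ∀ s ∈ Ioc (0 : ℝ) 1, ∀ y : ℝ,
      y ≤ (Real.exp (s * y) - 1) / s ∧ (Real.exp (s * y) - 1) / s ≤ Real.exp y := by
    intro s hs y
    rw [le_div_iff₀ hs.1, div_le_iff₀ hs.1]
    have h1 := Real.add_one_le_exp (s * y)
    have h2 := convexOn_exp.2 (mem_univ y) (mem_univ 0) hs.1.le (sub_nonneg.2 hs.2) (by ring)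
    simp only [smul_eq_mul, mul_zero, add_zero, Real.exp_zero, mul_one] at h2
    constructor
    · linarith
    · nlinarith [hs.1]
  have hint : ∀ s ∈ Ioc (0 : ℝ) 1, Integrable (fun x => Real.exp (s * Y x)) μ := by
    intro s hs
    refine ((hexp.const_mul s).add (integrable_const 1)).mono' (by fun_prop) (.of_forall fun x => ?_)
    have := (hconv s hs (Y x)).2
    rw [div_le_iff₀ hs.1] at this
    rw [Real.norm_of_nonneg (Real.exp_nonneg _)]
    simp only [Pi.add_apply]
    linarith
  have hmem : ∀ᶠ s : ℝ in 𝓝[>] 0, s ∈ Ioc (0 : ℝ) 1 := Ioc_mem_nhdsGT one_pos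
  have hlim : Tendsto (fun s : ℝ => ∫ x, (Real.exp (s * Y x) - 1) / s ∂μ) (𝓝[>] 0)
      (𝓝 (∫ x, Y x ∂μ)) := by
    refine tendsto_integral_filter_of_dominated_convergence (fun x => |Y x| + Real.exp (Y x))
      (.of_forall fun s => by fun_prop) ?_ (hY.abs.add hexp) (.of_forall fun x => ?_)
    · filter_upwards [hmem] with s hs
      refine .of_forall fun x => ?_
      obtain ⟨h1, h2⟩ := hconv s hs (Y x)
      rw [Real.norm_eq_abs, abs_le]
      have := neg_abs_le (Y x)
      have := abs_nonneg (Y x)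
      have := Real.exp_pos (Y x)
      constructor <;> linarith
    · have hd : HasDerivAt (fun s : ℝ => Real.exp (s * Y x)) (Y x) 0 := by
        have := ((hasDerivAt_id (0 : ℝ)).mul_const (Y x)).exp
        simpa using this
      have := hd.tendsto_slope_zero.mono_left
        (nhdsWithin_mono 0 fun s (hs : s ∈ Ioi (0 : ℝ)) => ne_of_gt hs)
      simpa [div_eq_inv_mul] using this
  obtain ⟨s, hs, hlt⟩ := (hmem.and (hlim.eventually_lt_const hneg)).exists
  refine ⟨s, hs.1, hint s hs, ?_⟩
  rw [integral_div, integral_sub (hint s hs) (integrable_const 1), div_lt_iff₀ hs.1] at hlt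
  simp at hlt
  linarith

/-- The log-ratio shifted by `I 0 - ε` has `P 0`-mean `-ε`, and its exponential is integrable
because the likelihood ratio has `P 0`-mean one. Thus no moment assumption beyond the divergence is
needed. -/
lemma exists_P_zero_avgLlr_gt_le (hH : H.Regular) {ε : ℝ} (hε : 0 < ε) :
    ∃ ρ > 0, ∀ n : ℕ,
      (H.P 0).real {ω | -H.I 0 + ε < H.avgLlr n ω} ≤ Real.exp (-(ρ * n)) := by
  have hZ := H.measurable_logRatio
  obtain ⟨hint, -⟩ := integrable_and_integral_of_lintegral (μ := H.law 0)
    (g := fun x => Real.exp (Real.log (H.f 1 x / H.f 0 x))) (by fun_prop)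
    (fun _ => Real.exp_nonneg _) (by
      rw [← setLIntegral_univ, ← withDensity_apply _ .univ, ← law_one_eq hH.ac01 hH.ac10,
        measure_univ])
  obtain ⟨s, hs, hsint, hlt⟩ := exists_integral_exp_lt_one (μ := H.law 0)
    (Y := fun x => Real.log (H.f 1 x / H.f 0 x) + (H.I 0 - ε)) (by fun_prop)
    (hH.integrable.add (integrable_const _))
    (by simp only [Real.exp_add]; exact hint.mul_const _)
    (by rw [integral_add hH.integrable (integrable_const _), hH.integral_eq]; simp [hε])
  set q := ∫ x, Real.exp (s * (Real.log (H.f 1 x / H.f 0 x) + (H.I 0 - ε))) ∂(H.law 0) with hq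
  have hq0 : 0 < q := integral_exp_pos hsint
  refine ⟨-Real.log q, neg_pos.2 (Real.log_neg hq0 hlt), fun n => ?_⟩
  rcases Nat.eq_zero_or_pos n with rfl | hn
  · simp
  have h := H.P_sum_nonneg_le 0 (by fun_prop) hsint n
  rw [← hq] at h
  rw [neg_mul, neg_neg, mul_comm, Real.exp_nat_mul, Real.exp_log hq0]
  refine le_trans (measureReal_mono fun ω hω => ?_) h
  have hω' : (-H.I 0 + ε) * n < H.llr n ω := by
    rwa [mem_ofPred_eq, avgLlr, lt_div_iff₀ (by positivity)] at hω
  simp only [mem_ofPred_eq, ← Finset.mul_sum, Finset.sum_add_distrib, Finset.sum_const,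
    Finset.card_range, nsmul_eq_mul]
  rw [llr] at hω'
  exact mul_nonneg hs.le (by linarith)

lemma tendsto_P_zero_llr_lt (hH : H.Regular) {ε : ℝ} (hε : 0 < ε) :
    Tendsto (fun n : ℕ => (H.P 0).real {ω | H.llr n ω < -((H.I 0 + ε) * n)}) atTop (𝓝 0) := by
  have hZ := H.measurable_logRatio
  let X : ℕ → (ℕ → S) → ℝ := fun k ω => Real.log (H.f 1 (ω k) / H.f 0 (ω k))
  have hint := hH.integrable
  have hX0 : Integrable (X 0) (H.P 0) := by
    rw [← H.map_coord 0 0] at hint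
    exact hint.comp_measurable (measurable_pi_apply 0)
  have hmean : ∫ ω, X 0 ω ∂(H.P 0) = -H.I 0 := by
    rw [← hH.integral_eq]
    exact H.integral_coord 0 0 hZ
  have hind : ProbabilityTheory.iIndepFun X (H.P 0) :=
    ProbabilityTheory.iIndepFun_infinitePi fun _ => hZ
  have hlaw := ProbabilityTheory.strong_law_ae_real X hX0 (fun i j hij => hind.indepFun hij)
    fun k => ProbabilityTheory.IdentDistrib.comp (u := fun x => Real.log (H.f 1 x / H.f 0 x))
      (f := fun ω : ℕ → S => ω k) (g := fun ω : ℕ → S => ω 0)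
      ⟨(measurable_pi_apply k).aemeasurable, (measurable_pi_apply 0).aemeasurable,
        by rw [map_coord, map_coord]⟩ hZ
  rw [hmean] at hlaw
  have hconv := tendstoInMeasure_of_tendsto_ae (fun n => (H.measurable_avgLlr n).aestronglyMeasurable) hlaw
    (ENNReal.ofReal ε) (by simpa using hε)
  have hconv' := (ENNReal.continuousAt_toReal ENNReal.zero_ne_top).tendsto.comp hconv
  rw [ENNReal.toReal_zero] at hconv'
  refine squeeze_zero' (.of_forall fun _ => measureReal_nonneg) ?_ hconv'
  filter_upwards [eventually_gt_atTop 0] with n hn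
  refine measureReal_mono fun ω hω => ?_
  have hn' : (0 : ℝ) < n := by exact_mod_cast hn
  have hlt : H.llr n ω / n < -(H.I 0 + ε) := by
    rw [div_lt_iff₀ hn']
    rwa [neg_mul]
  simp only [mem_ofPred_eq]
  rw [edist_dist, Real.dist_eq]
  refine ENNReal.ofReal_le_ofReal ?_
  rw [abs_sub_comm]
  refine le_trans ?_ (le_abs_self _)
  change ε ≤ -H.I 0 - H.llr n ω / n
  linarith

/-! ### Sample sizes that are necessary, or sufficient, for given error levels -/

/-- Stein's converse: split `A` according to whether `llr ≥ -t`. The first part costs `exp t * δ` by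
change of measure, the second is rare by the law of large numbers. All admissible `N` are treated at
once by viewing `A` as an event of the largest one, `n δ`, which tends to infinity as `δ → 0`. -/
lemma exists_P_zero_le (hH : H.Regular) {ε : ℝ} (hε : 0 < ε) (hε1 : ε < 1) :
    ∃ η > 0, η < 1 ∧ ∀ δ ∈ Ioo 0 η, ∀ N : ℕ, N * H.I 0 ≤ (1 - ε) * -Real.log δ →
      ∀ A, MeasurableSet[obs S N] A → (H.P 1).real A ≤ δ → (H.P 0).real A ≤ ε := by
  have hI := hH.I_pos
  have hL : Tendsto (fun δ : ℝ => -Real.log δ) (𝓝[>] 0) atTop :=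
    tendsto_neg_atBot_atTop.comp Real.tendsto_log_nhdsGT_zero
  let n : ℝ → ℕ := fun δ => ⌊(1 - ε) / H.I 0 * -Real.log δ⌋₊
  have hn : Tendsto n (𝓝[>] 0) atTop :=
    tendsto_nat_floor_atTop.comp (hL.const_mul_atTop (div_pos (by linarith) hI))
  have h1 : ∀ᶠ δ in 𝓝[>] (0 : ℝ), (H.P 0).real
      {ω | H.llr (n δ) ω < -((H.I 0 + ε * H.I 0) * n δ)} < ε / 2 :=
    hn.eventually ((tendsto_P_zero_llr_lt hH (mul_pos hε hI)).eventually_lt_const (half_pos hε))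
  have h2 : ∀ᶠ δ in 𝓝[>] (0 : ℝ), Real.exp (-(ε ^ 2 * -Real.log δ)) < ε / 2 :=
    (Real.tendsto_exp_neg_atTop_nhds_zero.comp
      (hL.const_mul_atTop (pow_pos hε 2))).eventually_lt_const (half_pos hε)
  have h3 : ∀ᶠ δ in 𝓝[>] (0 : ℝ), δ < 1 := eventually_nhdsWithin_of_eventually_nhds
    (eventually_lt_nhds one_pos)
  obtain ⟨η, hη, hsub⟩ := mem_nhdsGT_iff_exists_Ioo_subset.1 (h1.and (h2.and h3))
  have hη : 0 < η := hη
  refine ⟨min η (1 / 2), by positivity, by linarith [min_le_right η (1 / 2)], ?_⟩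
  intro δ hδ N hN A hA hA1
  obtain ⟨g1, g2, g3⟩ := hsub ⟨hδ.1, hδ.2.trans_le (min_le_left _ _)⟩
  have hLpos : 0 < -Real.log δ := neg_pos.2 (Real.log_neg hδ.1 g3)
  have hNn : N ≤ n δ := Nat.le_floor (by rw [div_mul_eq_mul_div, le_div_iff₀ hI]; exact hN)
  have hnle : (n δ : ℝ) * H.I 0 ≤ (1 - ε) * -Real.log δ := by
    rw [← le_div_iff₀ hI, ← div_mul_eq_mul_div]
    exact Nat.floor_le (mul_nonneg (div_nonneg (by linarith) hI.le) hLpos.le)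
  -- As `1 - ε ^ 2 = (1 + ε) (1 - ε)`, this exceeds the typical size `(1 + ε) * I 0 * n δ` of
  -- `-llr`, yet `exp t * δ = exp (-ε ^ 2 |log δ|)` is still small.
  set t := (1 - ε ^ 2) * -Real.log δ with ht
  have hcm := P_zero_inter_le hH (obs_mono hNn A hA) t
  have hfirst : Real.exp t * (H.P 1).real A ≤ ε / 2 := by
    calc _ ≤ Real.exp t * δ := by gcongr
      _ = Real.exp (-(ε ^ 2 * -Real.log δ)) := by
        conv_lhs => rw [← Real.exp_log hδ.1]
        rw [← Real.exp_add, ht]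
        congr 1
        ring
      _ ≤ _ := g2.le
  have hsecond : (H.P 0).real {ω | H.llr (n δ) ω < -t} ≤ ε / 2 := by
    refine le_trans (measureReal_mono fun ω hω => ?_) g1.le
    rw [mem_ofPred_eq] at hω ⊢
    refine hω.trans_le (neg_le_neg ?_)
    nlinarith [hnle, hε]
  calc (H.P 0).real A ≤ (H.P 0).real ((A ∩ {ω | -t ≤ H.llr (n δ) ω}) ∪
        {ω | H.llr (n δ) ω < -t}) := by
        refine measureReal_mono fun ω hω => ?_
        rcases le_or_gt (-t) (H.llr (n δ) ω) with h | h
        · exact Or.inl ⟨hω, h⟩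
        · exact Or.inr h
    _ ≤ _ := measureReal_union_le _ _
    _ ≤ ε := by linarith

lemma exists_errors_le (hH : H.Regular) {κ : ℝ} (hκ : κ < H.I 0) :
    ∃ ρ > 0, ∃ c : ℝ, ∀ (n : ℕ) (a δ : ℝ), 0 < a → 0 < δ → -Real.log a ≤ ρ * n →
      -Real.log δ ≤ κ * n →
      (H.P 0).real {ω | c < H.avgLlr n ω} ≤ a ∧ (H.P 1).real {ω | H.avgLlr n ω ≤ c} ≤ δ := by
  obtain ⟨ρ, hρ, h⟩ := exists_P_zero_avgLlr_gt_le hH (sub_pos.2 hκ)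
  refine ⟨ρ, hρ, -κ, fun n a δ ha hδ h1 h2 => ⟨?_, ?_⟩⟩
  · have := h n
    rw [neg_add_eq_sub, sub_sub_cancel_left] at this
    refine this.trans ?_
    rw [← Real.le_log_iff_exp_le ha]
    linarith
  · refine (P_one_avgLlr_le hH n (-κ)).trans ?_
    rw [← Real.le_log_iff_exp_le hδ]
    linarith

/-- The infimum defining `nStar` is over a nonempty set, hence attained and not the default `0`. -/
lemma exists_nStar (hH : H.Regular) {a δ : ℝ} (ha : 0 < a) (hδ : 0 < δ) :
    1 ≤ H.nStar a δ ∧ ∃ c : ℝ, (H.P 0).real {ω | c < H.avgLlr (H.nStar a δ) ω} ≤ a ∧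
      (H.P 1).real {ω | H.avgLlr (H.nStar a δ) ω ≤ c} ≤ δ := by
  have hI := hH.I_pos
  obtain ⟨ρ, hρ, c, h⟩ := exists_errors_le hH (half_lt_self hI)
  have h1 : ∀ᶠ n : ℕ in atTop, -Real.log a ≤ ρ * n :=
    (tendsto_natCast_atTop_atTop.const_mul_atTop hρ).eventually_ge_atTop _
  have h2 : ∀ᶠ n : ℕ in atTop, -Real.log δ ≤ H.I 0 / 2 * n :=
    (tendsto_natCast_atTop_atTop.const_mul_atTop (half_pos hI)).eventually_ge_atTop _
  obtain ⟨n, h1, h2, h3⟩ := (h1.and (h2.and (eventually_ge_atTop 1))).exists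
  have hne : {n : ℕ | 1 ≤ n ∧ ∃ c : ℝ, (H.P 0).real {ω | c < H.avgLlr n ω} ≤ a ∧
      (H.P 1).real {ω | H.avgLlr n ω ≤ c} ≤ δ}.Nonempty := ⟨n, h3, c, h n a δ ha hδ h1 h2⟩
  exact Nat.sInf_mem hne

lemma nStar_le {a δ : ℝ} {n : ℕ} (hn : 1 ≤ n) {c : ℝ}
    (h : (H.P 0).real {ω | c < H.avgLlr n ω} ≤ a ∧ (H.P 1).real {ω | H.avgLlr n ω ≤ c} ≤ δ) :
    H.nStar a δ ≤ n :=
  Nat.sInf_le ⟨hn, c, h⟩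

/-- Continuity from below: `{b < X}` is the increasing union of the `{u n < X}`. Hence an infimum of
thresholds keeps the type-I constraint; the type-II constraint is monotone. -/
lemma measureReal_lt_inter_le_of_tendsto {Ω : Type*} [MeasurableSpace Ω] {μ : Measure Ω}
    [IsFiniteMeasure μ] {X : Ω → ℝ} {A : Set Ω} {u : ℕ → EReal} {b : EReal} {a : ℝ}
    (hu : Antitone u) (hlim : Tendsto u atTop (𝓝 b))
    (h : ∀ n, μ.real ({ω | u n < (X ω : EReal)} ∩ A) ≤ a) :
    μ.real ({ω | b < (X ω : EReal)} ∩ A) ≤ a := by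
  have hunion : {ω | b < (X ω : EReal)} ∩ A = ⋃ n, {ω | u n < (X ω : EReal)} ∩ A := by
    rw [← iUnion_inter]
    congr 1
    ext ω
    simp only [mem_ofPred_eq, mem_iUnion]
    exact ⟨fun hω => (hlim.eventually_lt_const hω).exists,
      fun ⟨n, hn⟩ => (hu.le_of_tendsto hlim n).trans_lt hn⟩
  have hmono : Monotone fun n => {ω | u n < (X ω : EReal)} ∩ A := fun m n hmn =>
    inter_subset_inter_left _ fun ω hω => (hu hmn).trans_lt hω
  have := (ENNReal.continuousAt_toReal (measure_ne_top μ _)).tendsto.comp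
    (tendsto_measure_iUnion_atTop (μ := μ) hmono)
  rw [hunion]
  exact le_of_tendsto this (.of_forall h)

lemma cStar_spec (hH : H.Regular) {a δ : ℝ} (ha : 0 < a) (ha1 : a < 1) (hδ : 0 < δ) :
    (H.P 0).real {ω | H.cStar a δ < H.avgLlr (H.nStar a δ) ω} ≤ a ∧
      (H.P 1).real {ω | H.avgLlr (H.nStar a δ) ω ≤ H.cStar a δ} ≤ δ := by
  obtain ⟨-, c, hc⟩ := exists_nStar hH ha hδ
  set n := H.nStar a δ with hn
  let T : Set ℝ := {c | (H.P 0).real {ω | c < H.avgLlr n ω} ≤ a ∧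
    (H.P 1).real {ω | H.avgLlr n ω ≤ c} ≤ δ}
  have hcT : H.cStar a δ = sInf T := rfl
  -- Here `a < 1` matters: very low thresholds are exceeded with `P 0`-probability close to one.
  -- Without a lower bound, the real `sInf` would be the default `0`.
  have hbdd : BddBelow T := by
    have hun : (⋃ k : ℕ, {ω | -(k : ℝ) < H.avgLlr n ω}) = univ := by
      refine eq_univ_of_forall fun ω => ?_
      obtain ⟨k, hk⟩ := exists_nat_gt (-H.avgLlr n ω)
      exact mem_iUnion.2 ⟨k, by simp only [mem_ofPred_eq]; linarith⟩
    have hmono : Monotone fun k : ℕ => {ω | -(k : ℝ) < H.avgLlr n ω} := by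
      intro k l hkl ω hω
      rw [mem_ofPred_eq] at hω ⊢
      exact lt_of_le_of_lt (neg_le_neg (Nat.cast_le.2 hkl)) hω
    have := (ENNReal.continuousAt_toReal (measure_ne_top (H.P 0) _)).tendsto.comp
      (tendsto_measure_iUnion_atTop (μ := H.P 0) hmono)
    rw [hun, measure_univ, ENNReal.toReal_one] at this
    obtain ⟨k, hk⟩ := (this.eventually_const_lt ha1).exists
    refine ⟨-k, fun x hx => ?_⟩
    by_contra! hlt
    refine absurd hx.1 (not_le.2 (hk.trans_le ?_))
    exact measureReal_mono fun ω hω => hlt.trans hω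
  have hne : T.Nonempty := ⟨c, hc⟩
  refine ⟨?_, ?_⟩
  · obtain ⟨u, hu, hlim, huT⟩ := exists_seq_tendsto_sInf hne hbdd
    have := measureReal_lt_inter_le_of_tendsto (μ := H.P 0) (X := H.avgLlr n) (A := univ) (a := a)
      (u := fun k => (u k : EReal)) (b := (sInf T : ℝ)) (fun k l h => EReal.coe_le_coe (hu h))
      ((continuous_coe_real_ereal.tendsto _).comp hlim) fun k => by simpa using (huT k).1
    simpa [hcT] using this
  · refine le_trans (measureReal_mono fun ω hω => ?_) hc.2
    exact le_trans hω (csInf_le hbdd hc)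

lemma sInf_modThresholds_spec {A : Set (ℕ → S)} {N : ℕ} {a δ : ℝ}
    (hne : (H.modThresholds A N a δ).Nonempty) :
    (H.P 0).real ({ω | sInf ((fun b : ℝ => (b : EReal)) '' H.modThresholds A N a δ) <
        (H.avgLlr N ω : EReal)} ∩ A) ≤ a ∧
      (H.P 1).real {ω | (H.avgLlr N ω : EReal) ≤
        sInf ((fun b : ℝ => (b : EReal)) '' H.modThresholds A N a δ)} ≤ δ := by
  refine ⟨?_, ?_⟩
  · obtain ⟨u, hu, hlim, huT⟩ := exists_seq_tendsto_sInf
      (hne.image fun b : ℝ => (b : EReal)) (OrderBot.bddBelow _)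
    refine measureReal_lt_inter_le_of_tendsto hu hlim fun k => ?_
    obtain ⟨b, hb, hbu⟩ := huT k
    rw [← hbu]
    simpa using hb.1
  · obtain ⟨c, hc⟩ := hne
    refine le_trans (measureReal_mono fun ω hω => ?_) hc.2
    exact EReal.coe_le_coe_iff.1 (le_trans hω (sInf_le ⟨c, hc, rfl⟩))

/-! ### Tests in stages -/

section Staged

set_option linter.unusedSectionVars false

variable {K : ℕ} {M : ℕ → ℕ} {stat : ℕ → (ℕ → S) → ℝ} {b : ℕ → EReal}

/-- The event that the thresholds are exceeded at the stages `1, …, j`. -/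
def passedAll (stat : ℕ → (ℕ → S) → ℝ) (b : ℕ → EReal) (j : ℕ) : Set (ℕ → S) :=
  {ω | ∀ i ∈ Finset.Icc 1 j, b i < (stat i ω : EReal)}

lemma lastStage_spec (hK : 1 ≤ K) (ω : ℕ → S) :
    1 ≤ lastStage K stat b ω ∧
      (lastStage K stat b ω = K ∨ (stat (lastStage K stat b ω) ω : EReal) ≤
        b (lastStage K stat b ω)) := by
  have hne : {j : ℕ | 1 ≤ j ∧ (j = K ∨ (stat j ω : EReal) ≤ b j)}.Nonempty := ⟨K, hK, Or.inl rfl⟩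
  exact Nat.sInf_mem hne

lemma lastStage_le {j : ℕ} {ω : ℕ → S} (hj : 1 ≤ j) (h : j = K ∨ (stat j ω : EReal) ≤ b j) :
    lastStage K stat b ω ≤ j :=
  Nat.sInf_le ⟨hj, h⟩

lemma lastStage_le_top (hK : 1 ≤ K) (ω : ℕ → S) : lastStage K stat b ω ≤ K :=
  lastStage_le hK (Or.inl rfl)

lemma lt_stat_of_lt_lastStage {i : ℕ} {ω : ℕ → S} (hi : 1 ≤ i) (h : i < lastStage K stat b ω) :
    b i < (stat i ω : EReal) := by
  by_contra! hle
  exact absurd (lastStage_le (K := K) hi (Or.inr hle)) (not_le.2 h)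

lemma mem_passedAll_lastStage (ω : ℕ → S) :
    ω ∈ passedAll stat b (lastStage K stat b ω - 1) := fun i hi => by
  rw [Finset.mem_Icc] at hi
  exact lt_stat_of_lt_lastStage (K := K) hi.1 (by omega)

lemma lastStage_eq_of_mem_passedAll (hK : 1 ≤ K) {ω : ℕ → S} (h : ω ∈ passedAll stat b K) :
    lastStage K stat b ω = K := by
  obtain ⟨h1, h2⟩ := lastStage_spec (stat := stat) (b := b) hK ω
  refine h2.resolve_right (not_le.2 (h _ (Finset.mem_Icc.2 ⟨h1, lastStage_le_top hK ω⟩)))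

lemma lastStage_eq_iff (hK : 1 ≤ K) {j : ℕ} (hj : j ∈ Finset.Icc 1 K) (ω : ℕ → S) :
    lastStage K stat b ω = j ↔
      ω ∈ passedAll stat b (j - 1) ∧ (j = K ∨ (stat j ω : EReal) ≤ b j) := by
  rw [Finset.mem_Icc] at hj
  constructor
  · rintro rfl
    exact ⟨mem_passedAll_lastStage ω, (lastStage_spec hK ω).2⟩
  · rintro ⟨h1, h2⟩
    refine le_antisymm (lastStage_le hj.1 h2) ?_
    by_contra! hlt
    obtain ⟨g1, g2⟩ := lastStage_spec (stat := stat) (b := b) hK ω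
    rcases g2 with g2 | g2
    · omega
    · exact absurd (h1 _ (Finset.mem_Icc.2 ⟨g1, by omega⟩)) (not_lt.2 g2)

lemma stagedTest_snd_eq_one_iff (ω : ℕ → S) :
    (stagedTest K M stat b).2 ω = 1 ↔ ω ∈ passedAll stat b K := by
  simp [stagedTest, passedAll]

lemma stagedTest_snd_eq_zero_iff (ω : ℕ → S) :
    (stagedTest K M stat b).2 ω = 0 ↔ ω ∉ passedAll stat b K := by
  simp [stagedTest, passedAll]

/-- The statistic of each stage depends only on the observations collected by its end. -/
structure Adapted (K : ℕ) (M : ℕ → ℕ) (stat : ℕ → (ℕ → S) → ℝ) : Prop where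
  one_le : 1 ≤ K
  one_le_size : 1 ≤ M 1
  mono : ∀ i j, 1 ≤ i → i ≤ j → j ≤ K → M i ≤ M j
  measurable : ∀ j, 1 ≤ j → j ≤ K → Measurable[obs S (M j)] (stat j)

lemma Adapted.measurableSet_lt (h : Adapted K M stat) {i j : ℕ} (hi : 1 ≤ i) (hij : i ≤ j)
    (hj : j ≤ K) : MeasurableSet[obs S (M j)] {ω | b i < (stat i ω : EReal)} := by
  refine obs_mono (h.mono i j hi hij hj) _ ?_
  exact (measurable_coe_real_ereal.comp (h.measurable i hi (hij.trans hj))) measurableSet_Ioi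

lemma Adapted.measurableSet_passedAll (h : Adapted K M stat) {i j : ℕ} (hij : i ≤ j) (hj : j ≤ K) :
    MeasurableSet[obs S (M j)] (passedAll stat b i) := by
  have : passedAll stat b i = ⋂ k ∈ Finset.Icc 1 i, {ω | b k < (stat k ω : EReal)} := by
    ext ω
    simp [passedAll]
  rw [this]
  refine Finset.measurableSet_biInter _ fun k hk => ?_
  rw [Finset.mem_Icc] at hk
  exact h.measurableSet_lt hk.1 (hk.2.trans hij) hj

lemma Adapted.measurableSet_passedAll' (h : Adapted K M stat) {i : ℕ} (hi : i ≤ K) :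
    MeasurableSet (passedAll stat b i) :=
  obs_le _ _ (h.measurableSet_passedAll hi le_rfl)

lemma Adapted.measurableSet_lastStage_eq (h : Adapted K M stat) {j : ℕ}
    (hj : j ∈ Finset.Icc 1 K) : MeasurableSet[obs S (M j)] {ω | lastStage K stat b ω = j} := by
  have hj' := Finset.mem_Icc.1 hj
  simp only [lastStage_eq_iff h.one_le hj]
  have h1 := h.measurableSet_passedAll (b := b) (Nat.sub_le j 1) hj'.2
  have h2 : MeasurableSet[obs S (M j)] {ω | j = K ∨ (stat j ω : EReal) ≤ b j} := by
    by_cases hjK : j = K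
    · simp only [hjK, true_or]
      exact MeasurableSet.univ
    · simp only [hjK, false_or]
      have := (h.measurableSet_lt (b := b) hj'.1 le_rfl hj'.2).compl
      convert this using 1
      ext ω
      simp
  exact h1.inter h2

lemma Adapted.isTest (h : Adapted K M stat) :
    H.IsTest (stagedTest K M stat b).1 (stagedTest K M stat b).2 := by
  have hT : ∀ n : ℕ, 1 ≤ n → MeasurableSet[obs S n] {ω | (stagedTest K M stat b).1 ω = n} := by
    intro n _
    -- Several stages may end at the same time, since later stages of mod-ST can have size zero.
    have : {ω | (stagedTest K M stat b).1 ω = n} =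
        ⋃ j ∈ (Finset.Icc 1 K).filter (M · = n), {ω | lastStage K stat b ω = j} := by
      ext ω
      simp only [stagedTest, mem_ofPred_eq, Nat.cast_inj, mem_iUnion, Finset.mem_filter,
        Finset.mem_Icc, exists_prop]
      constructor
      · exact fun hω => ⟨_, ⟨⟨(lastStage_spec h.one_le ω).1, lastStage_le_top h.one_le ω⟩, hω⟩, rfl⟩
      · rintro ⟨j, ⟨-, hj⟩, rfl⟩
        exact hj
    rw [this]
    refine Finset.measurableSet_biUnion _ fun j hj => ?_
    rw [Finset.mem_filter] at hj
    rw [← hj.2]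
    exact h.measurableSet_lastStage_eq hj.1
  have hrej : ∀ n : ℕ, 1 ≤ n → MeasurableSet[obs S n]
      {ω | (stagedTest K M stat b).1 ω = n ∧ (stagedTest K M stat b).2 ω = 1} := by
    intro n _
    simp only [stagedTest_snd_eq_one_iff]
    by_cases hn : M K = n
    · convert h.measurableSet_passedAll (b := b) (le_refl K) le_rfl using 1
      · rw [hn]
      · ext ω
        refine and_iff_right_of_imp fun hω => ?_
        simp [stagedTest, lastStage_eq_of_mem_passedAll h.one_le hω, hn]
    · convert MeasurableSet.empty
      ext ω
      simp only [mem_ofPred_eq, mem_empty_iff_false, iff_false, not_and]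
      intro hω hp
      simp only [stagedTest, lastStage_eq_of_mem_passedAll h.one_le hp, Nat.cast_inj] at hω
      exact hn hω
  refine ⟨fun ω => ?_, fun i => .of_forall fun ω => ENat.natCast_ne_top _, hT, ?_, ?_⟩
  · have := h.one_le_size.trans (h.mono 1 _ le_rfl (lastStage_spec (stat := stat) (b := b)
      h.one_le ω).1 (lastStage_le_top h.one_le ω))
    simpa [stagedTest] using this
  · have := h.measurableSet_passedAll' (b := b) (le_refl K)
    exact Measurable.ite this measurable_const measurable_const
  · intro n hn i
    fin_cases i
    · convert (hT n hn).diff (hrej n hn) using 1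
      ext ω
      simp only [Fin.zero_eta, mem_ofPred_eq, Set.mem_sdiff, stagedTest_snd_eq_zero_iff,
        stagedTest_snd_eq_one_iff]
      tauto
    · exact hrej n hn

lemma P_accept_le (i : Fin 2) :
    (H.P i).real {ω | (stagedTest K M stat b).2 ω = 0} ≤
      ∑ j ∈ Finset.Icc 1 K, (H.P i).real {ω | (stat j ω : EReal) ≤ b j} := by
  refine le_trans (measureReal_mono ?_ (measure_ne_top _ _)) (measureReal_biUnion_finset_le _ _)
  intro ω hω
  rw [mem_ofPred_eq, stagedTest_snd_eq_zero_iff] at hω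
  simpa [passedAll, and_assoc] using hω

lemma Adapted.mem_testClass (h : Adapted K M stat) {α β : ℝ}
    (hα : (H.P 0).real (passedAll stat b K) ≤ α)
    (hβ : ∑ j ∈ Finset.Icc 1 K, (H.P 1).real {ω | (stat j ω : EReal) ≤ b j} ≤ β) :
    stagedTest K M stat b ∈ H.testClass α β := by
  refine ⟨h.isTest, ?_, (P_accept_le 1).trans hβ⟩
  simp only [stagedTest_snd_eq_one_iff]
  exact hα

lemma Adapted.ess_le (h : Adapted K M stat) (i : Fin 2) :
    H.ess i (stagedTest K M stat b).1 ≤ M K := by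
  calc _ ≤ ∫⁻ _, (M K : ℝ≥0∞) ∂(H.P i) := by
        refine lintegral_mono fun ω => ?_
        simp only [stagedTest, ENat.toENNReal_coe, Nat.cast_le]
        exact h.mono _ _ (lastStage_spec h.one_le ω).1 (lastStage_le_top h.one_le ω) le_rfl
    _ = M K := by simp

lemma Adapted.le_ess (h : Adapted K M stat) (i : Fin 2) :
    M K * H.P i (passedAll stat b K) ≤ H.ess i (stagedTest K M stat b).1 := by
  have hm := h.measurableSet_passedAll' (b := b) (le_refl K)
  calc _ = ∫⁻ ω, (passedAll stat b K).indicator (fun _ => (M K : ℝ≥0∞)) ω ∂(H.P i) := by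
        rw [lintegral_indicator_const hm]
    _ ≤ _ := by
        refine lintegral_mono fun ω => indicator_apply_le' (fun hω => ?_) fun _ => zero_le
        simp [stagedTest, lastStage_eq_of_mem_passedAll h.one_le hω]

lemma Adapted.ess_le_sum (h : Adapted K M stat) (i : Fin 2) :
    H.ess i (stagedTest K M stat b).1 ≤
      M 1 + ∑ j ∈ Finset.Icc 2 K, M j * H.P i (passedAll stat b (j - 1)) := by
  have hm : ∀ j ∈ Finset.Icc 2 K, MeasurableSet (passedAll stat b (j - 1)) := fun j hj =>
    h.measurableSet_passedAll' (by rw [Finset.mem_Icc] at hj; omega)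
  calc _ ≤ ∫⁻ ω, (M 1 + ∑ j ∈ Finset.Icc 2 K,
          (passedAll stat b (j - 1)).indicator (fun _ => (M j : ℝ≥0∞)) ω) ∂(H.P i) := by
        refine lintegral_mono fun ω => ?_
        have h1 := (lastStage_spec (stat := stat) (b := b) h.one_le ω).1
        have hle := lastStage_le_top (stat := stat) (b := b) h.one_le ω
        simp only [stagedTest, ENat.toENNReal_coe]
        rcases h1.eq_or_lt with heq | hlt
        · rw [← heq]
          exact le_self_add
        · refine le_add_of_nonneg_of_le (zero_le) ?_
          refine le_trans ?_ (Finset.single_le_sum (fun _ _ => zero_le)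
            (Finset.mem_Icc.2 ⟨hlt, hle⟩))
          rw [indicator_of_mem (mem_passedAll_lastStage ω)]
    _ = _ := by
        rw [lintegral_add_left measurable_const, lintegral_finsetSum _ fun j hj =>
          measurable_const.indicator (hm j hj)]
        simp only [lintegral_const, measure_univ, mul_one]
        congr 1
        exact Finset.sum_congr rfl fun j hj => by rw [lintegral_indicator_const (hm j hj)]

/-- Since `(k + 2) ^ 2 ≤ 4 ^ (k + 1)`, the sum is dominated by a geometric series with ratio `4 a ≤
1 / 2` and first term `4 a`. -/
lemma sum_sq_mul_pow_le {a : ℝ} (ha : 0 ≤ a) (ha' : a ≤ 1 / 8) (K : ℕ) :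
    ∑ j ∈ Finset.Icc 2 K, (j : ℝ) ^ 2 * a ^ (j - 1) ≤ 8 * a := by
  have hsq : ∀ k : ℕ, ((k : ℝ) + 2) ^ 2 ≤ 4 ^ (k + 1) := by
    intro k
    induction k with
    | zero => norm_num
    | succ k ih =>
      push_cast
      rw [pow_succ 4 (k + 1)]
      nlinarith [(Nat.cast_nonneg k : (0 : ℝ) ≤ k)]
  have hterm : ∀ k : ℕ, ((k + 2 : ℕ) : ℝ) ^ 2 * a ^ (k + 1) ≤ 4 * a * (1 / 2) ^ k := by
    intro k
    push_cast
    calc ((k : ℝ) + 2) ^ 2 * a ^ (k + 1) ≤ 4 ^ (k + 1) * a ^ (k + 1) := by gcongr; exact hsq k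
      _ = 4 * a * (4 * a) ^ k := by rw [← mul_pow, pow_succ]; ring
      _ ≤ _ := by gcongr; linarith
  have hsum : ∀ n : ℕ, ∑ k ∈ Finset.range n, ((k + 2 : ℕ) : ℝ) ^ 2 * a ^ (k + 1) ≤
      8 * a * (1 - (1 / 2) ^ n) := by
    intro n
    induction n with
    | zero => simp
    | succ n ih =>
      rw [Finset.sum_range_succ, pow_succ (1 / 2 : ℝ)]
      linarith [hterm n]
  have hIcc : ∑ j ∈ Finset.Icc 2 K, (j : ℝ) ^ 2 * a ^ (j - 1) =
      ∑ k ∈ Finset.range (K - 1), ((k + 2 : ℕ) : ℝ) ^ 2 * a ^ (k + 1) := by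
    rw [show Finset.Icc 2 K = Finset.Ico 2 (K + 1) from rfl, Finset.sum_Ico_eq_sum_range]
    refine Finset.sum_congr (by congr 1) fun k _ => ?_
    rw [add_comm 2 k, show k + 2 - 1 = k + 1 from rfl]
  rw [hIcc]
  refine (hsum _).trans ?_
  have : (0 : ℝ) < (1 / 2) ^ (K - 1) := by positivity
  nlinarith

/-- Stage `j` is reached with probability at most `a ^ (j - 1)`, so its quadratically growing cost
is summable. The factor `j ^ 2` is generous enough for both ST and mod-ST. -/
lemma Adapted.ess_zero_le (h : Adapted K M stat) {B a : ℝ} (hB : 0 ≤ B) (ha : 0 ≤ a)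
    (ha' : a ≤ 1 / 8) (hM : ∀ j ∈ Finset.Icc 1 K, (M j : ℝ) ≤ j ^ 2 * B)
    (hP : ∀ j ∈ Finset.Icc 1 K, (H.P 0).real (passedAll stat b j) ≤ a ^ j) :
    H.ess 0 (stagedTest K M stat b).1 ≤ ENNReal.ofReal (B * (1 + 8 * a)) := by
  refine (h.ess_le_sum 0).trans ?_
  have hterm : ∀ j ∈ Finset.Icc 2 K, (M j : ℝ≥0∞) * H.P 0 (passedAll stat b (j - 1)) ≤
      ENNReal.ofReal (B * (j ^ 2 * a ^ (j - 1))) := by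
    intro j hj
    rw [Finset.mem_Icc] at hj
    rw [show B * ((j : ℝ) ^ 2 * a ^ (j - 1)) = j ^ 2 * B * a ^ (j - 1) by ring,
      ENNReal.ofReal_mul (by positivity), ← ENNReal.ofReal_natCast]
    refine mul_le_mul' (ENNReal.ofReal_le_ofReal (hM j (Finset.mem_Icc.2 (by omega)))) ?_
    rw [← ofReal_measureReal]
    exact ENNReal.ofReal_le_ofReal (hP _ (Finset.mem_Icc.2 (by omega)))
  have h1 : (M 1 : ℝ≥0∞) ≤ ENNReal.ofReal B := by
    rw [← ENNReal.ofReal_natCast]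
    have := hM 1 (Finset.mem_Icc.2 ⟨le_rfl, h.one_le⟩)
    exact ENNReal.ofReal_le_ofReal (by simpa using this)
  calc _ ≤ ENNReal.ofReal B + ∑ j ∈ Finset.Icc 2 K, ENNReal.ofReal (B * (j ^ 2 * a ^ (j - 1))) :=
        add_le_add h1 (Finset.sum_le_sum hterm)
    _ = ENNReal.ofReal (B + B * ∑ j ∈ Finset.Icc 2 K, (j : ℝ) ^ 2 * a ^ (j - 1)) := by
        rw [← ENNReal.ofReal_sum_of_nonneg fun j _ => by positivity, ← Finset.mul_sum,
          ← ENNReal.ofReal_add hB (mul_nonneg hB (Finset.sum_nonneg fun j _ => by positivity))]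
    _ ≤ _ := by
        refine ENNReal.ofReal_le_ofReal ?_
        rw [mul_add, mul_one]
        gcongr
        exact sum_sq_mul_pow_le ha ha' K

end Staged

/-! ### The error levels of the stages -/

lemma sum_pow_le_half {x : ℝ} (hx : 0 ≤ x) (hx' : x ≤ 1 / 2) (K : ℕ) :
    ∑ i ∈ Finset.Icc 2 K, x ^ i ≤ x := by
  have key : ∀ n : ℕ, ∑ i ∈ Finset.Icc 2 (n + 1), x ^ i ≤ x - x ^ (n + 1) := by
    intro n
    induction n with
    | zero => simp
    | succ n ih =>
      rw [Finset.sum_Icc_succ_top (by omega)]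
      have : x ^ (n + 1 + 1) ≤ x ^ (n + 1) * (1 / 2) := by
        rw [pow_succ x (n + 1)]
        gcongr
      linarith
  rcases Nat.eq_zero_or_pos K with rfl | hK
  · simpa using hx
  · obtain ⟨n, rfl⟩ := Nat.exists_eq_succ_of_ne_zero hK.ne'
    exact (key n).trans (sub_le_self _ (by positivity))

/-- The later levels sum to at most `β / 2`, leaving at least that much for stage `1`. -/
lemma half_pow_le_typeIILevel {β : ℝ} (hβ : β ∈ Ioo (0 : ℝ) 1) (K : ℕ) {j : ℕ} :
    (β / 2) ^ j ≤ typeIILevel β K j := by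
  unfold typeIILevel
  split_ifs with h
  · have := sum_pow_le_half (x := β / 2) (by linarith [hβ.1]) (by linarith [hβ.2]) K
    rw [h, pow_one]
    linarith
  · exact le_rfl

lemma typeIILevel_pos {β : ℝ} (hβ : β ∈ Ioo (0 : ℝ) 1) (K j : ℕ) : 0 < typeIILevel β K j :=
  (pow_pos (half_pos hβ.1) j).trans_le (half_pow_le_typeIILevel hβ K)

lemma typeIILevel_le_pow {β : ℝ} (hβ : β ∈ Ioo (0 : ℝ) 1) (K j : ℕ) :
    typeIILevel β K j ≤ β ^ j := by
  have h0 := hβ.1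
  unfold typeIILevel
  split_ifs with h
  · rw [h, pow_one]
    exact sub_le_self _ (Finset.sum_nonneg fun i _ => by positivity)
  · gcongr
    linarith

lemma sum_typeIILevel (β : ℝ) {K : ℕ} (hK : 1 ≤ K) :
    ∑ j ∈ Finset.Icc 1 K, typeIILevel β K j = β := by
  rw [← Finset.add_sum_Ioc_eq_sum_Icc hK]
  have : ∑ j ∈ Finset.Ioc 1 K, typeIILevel β K j = ∑ i ∈ Finset.Icc 2 K, (β / 2) ^ i := by
    refine Finset.sum_congr rfl fun j hj => ?_
    rw [typeIILevel, if_neg (by rw [Finset.mem_Icc] at hj; omega)]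
  rw [this, typeIILevel, if_pos rfl]
  ring

lemma rootLevel_mem {α : ℝ} (hα : α ∈ Ioo (0 : ℝ) 1) {K : ℕ} (hK : 1 ≤ K) :
    α ^ (1 / (K : ℝ)) ∈ Ioo (0 : ℝ) 1 :=
  ⟨Real.rpow_pos_of_pos hα.1 _, Real.rpow_lt_one hα.1.le hα.2 (by positivity)⟩

lemma rootLevel_pow {α : ℝ} (hα : α ∈ Ioo (0 : ℝ) 1) (K j : ℕ) :
    (α ^ (1 / (K : ℝ))) ^ j = α ^ ((j : ℝ) / K) := by
  rw [← Real.rpow_natCast, ← Real.rpow_mul hα.1.le]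
  congr 1
  ring

lemma rootLevel_pow_self {α : ℝ} (hα : α ∈ Ioo (0 : ℝ) 1) {K : ℕ} (hK : 1 ≤ K) :
    (α ^ (1 / (K : ℝ))) ^ K = α := by
  rw [rootLevel_pow hα, div_self (by positivity), Real.rpow_one]

/-! ### Sequential Thresholding -/

section ST

set_option linter.unusedSectionVars false

variable {α β : ℝ} {K : ℕ}

lemma one_le_stSize (hH : H.Regular) (hα : α ∈ Ioo (0 : ℝ) 1) (hβ : β ∈ Ioo (0 : ℝ) 1)
    (hK : 1 ≤ K) (j : ℕ) : 1 ≤ H.stSize α β K j :=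
  (exists_nStar hH (rootLevel_mem hα hK).1 (typeIILevel_pos hβ K j)).1

lemma stTotal_mono : Monotone (H.stTotal α β K) := fun _ _ h =>
  Finset.sum_le_sum_of_subset (Finset.Icc_subset_Icc_right h)

lemma stTotal_succ (j : ℕ) : H.stTotal α β K (j + 1) = H.stTotal α β K j + H.stSize α β K (j + 1) :=
  Finset.sum_Icc_succ_top (by omega) _

lemma adapted_ST (hH : H.Regular) (hα : α ∈ Ioo (0 : ℝ) 1) (hβ : β ∈ Ioo (0 : ℝ) 1)
    (hK : 1 ≤ K) : Adapted K (H.stTotal α β K) (H.stStat α β K) where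
  one_le := hK
  one_le_size := by simpa [stTotal] using one_le_stSize hH hα hβ hK 1
  mono := fun _ _ _ hij _ => stTotal_mono hij
  measurable := fun j _ _ => by
    have h1 := H.measurable_llr_obs (H.stTotal α β K j)
    have h2 := (H.measurable_llr_obs (H.stTotal α β K (j - 1))).mono
      (obs_mono (stTotal_mono (Nat.sub_le j 1))) le_rfl
    exact (h1.sub h2).div_const _

lemma stStat_succ (j : ℕ) (ω : ℕ → S) : H.stStat α β K (j + 1) ω =
    H.avgLlr (H.stSize α β K (j + 1)) fun k => ω (H.stTotal α β K j + k) := by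
  rw [stStat, stTotal_succ, llr_add, avgLlr, Nat.add_sub_cancel, add_sub_cancel_left]

lemma passedAll_succ {stat : ℕ → (ℕ → S) → ℝ} {b : ℕ → EReal} (j : ℕ) :
    passedAll stat b (j + 1) =
      passedAll stat b j ∩ {ω | b (j + 1) < (stat (j + 1) ω : EReal)} := by
  ext ω
  simp only [passedAll, mem_ofPred_eq, mem_inter_iff, Finset.mem_Icc]
  refine ⟨fun h => ⟨fun i hi => h i (by omega), h _ (by omega)⟩, fun h i hi => ?_⟩
  rcases hi.2.eq_or_lt with rfl | hlt
  · exact h.2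
  · exact h.1 i (by omega)

/-- The stages use disjoint blocks of observations, so each contributes an independent factor of at
most `α ^ (1 / K)`. -/
lemma P_zero_passedAll_ST_le (hH : H.Regular) (hα : α ∈ Ioo (0 : ℝ) 1) (hβ : β ∈ Ioo (0 : ℝ) 1)
    (hK : 1 ≤ K) {j : ℕ} (hj : j ≤ K) :
    (H.P 0).real (passedAll (H.stStat α β K) (fun j => (H.stThreshold α β K j : EReal)) j) ≤
      (α ^ (1 / (K : ℝ))) ^ j := by
  have ha := rootLevel_mem hα hK
  induction j with
  | zero => simp
  | succ j ih =>
    have hset : {ω | (H.stThreshold α β K (j + 1) : EReal) < (H.stStat α β K (j + 1) ω : EReal)} =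
        (fun ω k => ω (H.stTotal α β K j + k)) ⁻¹'
          {ω | H.stThreshold α β K (j + 1) < H.avgLlr (H.stSize α β K (j + 1)) ω} := by
      ext ω
      simp only [mem_ofPred_eq, mem_preimage, EReal.coe_lt_coe_iff, stStat_succ]
    rw [passedAll_succ, hset, Measure.real, P_inter_shift _ _
      ((adapted_ST hH hα hβ hK).measurableSet_passedAll le_rfl (by omega))
      (measurableSet_lt measurable_const (H.measurable_avgLlr _)), ENNReal.toReal_mul, pow_succ]
    have := (cStar_spec hH ha.1 ha.2 (typeIILevel_pos hβ K (j + 1))).1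
    exact mul_le_mul (ih (by omega)) this measureReal_nonneg (pow_pos ha.1 _).le

lemma P_one_stStat_le (hH : H.Regular) (hα : α ∈ Ioo (0 : ℝ) 1) (hβ : β ∈ Ioo (0 : ℝ) 1)
    (hK : 1 ≤ K) {j : ℕ} (hj : 1 ≤ j) :
    (H.P 1).real {ω | (H.stStat α β K j ω : EReal) ≤ (H.stThreshold α β K j : EReal)} ≤
      typeIILevel β K j := by
  have ha := rootLevel_mem hα hK
  obtain ⟨j, rfl⟩ := Nat.exists_eq_succ_of_ne_zero (Nat.one_le_iff_ne_zero.1 hj)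
  have hset : {ω | (H.stStat α β K (j + 1) ω : EReal) ≤ (H.stThreshold α β K (j + 1) : EReal)} =
      univ ∩ (fun ω k => ω (H.stTotal α β K j + k)) ⁻¹'
        {ω | H.avgLlr (H.stSize α β K (j + 1)) ω ≤ H.stThreshold α β K (j + 1)} := by
    ext ω
    simp only [mem_ofPred_eq, mem_preimage, EReal.coe_le_coe_iff, stStat_succ, univ_inter]
  rw [Nat.succ_eq_add_one, hset, Measure.real, P_inter_shift _ _ MeasurableSet.univ
    (measurableSet_le (H.measurable_avgLlr _) measurable_const), measure_univ, one_mul]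
  exact (cStar_spec hH ha.1 ha.2 (typeIILevel_pos hβ K (j + 1))).2

lemma ST_mem_testClass (hH : H.Regular) (hα : α ∈ Ioo (0 : ℝ) 1) (hβ : β ∈ Ioo (0 : ℝ) 1)
    (hK : 1 ≤ K) : H.ST α β K ∈ H.testClass α β := by
  refine (adapted_ST hH hα hβ hK).mem_testClass ?_ ?_
  · exact (P_zero_passedAll_ST_le hH hα hβ hK le_rfl).trans (rootLevel_pow_self hα hK).le
  · refine le_trans (Finset.sum_le_sum fun j hj => ?_) (sum_typeIILevel β hK).le
    exact P_one_stStat_le hH hα hβ hK (Finset.mem_Icc.1 hj).1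

end ST

/-! ### Modified Sequential Thresholding -/

section ModST

variable {r : ℕ} {α β : ℝ} {K : ℕ}

/-- Intersecting with `A` only relaxes the type-I constraint, so mod-ST never needs more than a
fixed-sample-size test on all the data at the same levels. -/
lemma modThresholds_nonempty {A : Set (ℕ → S)} {N : ℕ} {a δ c : ℝ}
    (h : (H.P 0).real {ω | c < H.avgLlr N ω} ≤ a ∧ (H.P 1).real {ω | H.avgLlr N ω ≤ c} ≤ δ) :
    (H.modThresholds A N a δ).Nonempty :=
  ⟨c, (measureReal_mono inter_subset_left).trans h.1, h.2⟩

lemma modSize_spec (hH : H.Regular) (r : ℕ) (s : ModStage S) {a δ : ℝ} (ha : 0 < a) (hδ : 0 < δ) :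
    (H.modThresholds s.passed (s.total + H.modSize r s a δ) a δ).Nonempty := by
  have hI := hH.I_pos
  obtain ⟨ρ, hρ, c, h⟩ := exists_errors_le hH (half_lt_self hI)
  have h1 : ∀ᶠ n : ℕ in atTop, -Real.log a ≤ ρ * n :=
    (tendsto_natCast_atTop_atTop.const_mul_atTop hρ).eventually_ge_atTop _
  have h2 : ∀ᶠ n : ℕ in atTop, -Real.log δ ≤ H.I 0 / 2 * n :=
    (tendsto_natCast_atTop_atTop.const_mul_atTop (half_pos hI)).eventually_ge_atTop _
  obtain ⟨n, h1, h2, h3⟩ := (h1.and (h2.and (eventually_ge_atTop (s.total + r)))).exists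
  have hne : {n : ℕ | r ≤ n ∧ (H.modThresholds s.passed (s.total + n) a δ).Nonempty}.Nonempty := by
    refine ⟨n - s.total, by omega, ?_⟩
    rw [Nat.add_sub_cancel' (by omega)]
    exact modThresholds_nonempty (h n a δ ha hδ h1 h2)
  exact (Nat.sInf_mem hne).2

lemma modNext_total_le (r : ℕ) (s : ModStage S) {a δ c : ℝ} {N : ℕ} (hN : s.total + r ≤ N)
    (h : (H.P 0).real {ω | c < H.avgLlr N ω} ≤ a ∧ (H.P 1).real {ω | H.avgLlr N ω ≤ c} ≤ δ) :
    (H.modNext r s a δ).total ≤ N := by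
  have hmem : N - s.total ∈
      {n : ℕ | r ≤ n ∧ (H.modThresholds s.passed (s.total + n) a δ).Nonempty} := by
    refine ⟨by omega, ?_⟩
    rw [Nat.add_sub_cancel' (by omega)]
    exact modThresholds_nonempty h
  have : H.modSize r s a δ ≤ N - s.total := Nat.sInf_le hmem
  simp only [modNext]
  omega

lemma modStage_total_mono (r : ℕ) (α β : ℝ) (K : ℕ) :
    Monotone fun j => (H.modStage r α β K j).total := by
  refine monotone_nat_of_le_succ fun j => ?_
  cases j with
  | zero => exact Nat.zero_le _
  | succ j => exact Nat.le_add_right _ _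

/-- The statistics of mod-ST. -/
noncomputable def modStat (H : SimpleTesting S) (r : ℕ) (α β : ℝ) (K j : ℕ) : (ℕ → S) → ℝ :=
  H.avgLlr (H.modStage r α β K j).total

/-- The thresholds of mod-ST. -/
noncomputable def modThreshold (H : SimpleTesting S) (r : ℕ) (α β : ℝ) (K j : ℕ) : EReal :=
  (H.modStage r α β K j).threshold

lemma adapted_modST (hH : H.Regular) (r : ℕ) (hα : α ∈ Ioo (0 : ℝ) 1) (hβ : β ∈ Ioo (0 : ℝ) 1)
    (hK : 1 ≤ K) : Adapted K (fun j => (H.modStage r α β K j).total) (H.modStat r α β K) where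
  one_le := hK
  one_le_size := one_le_stSize hH hα hβ hK 1
  mono := fun _ _ _ hij _ => modStage_total_mono r α β K hij
  measurable := fun _ _ _ => H.measurable_avgLlr_obs _

lemma modStage_passed (r : ℕ) (α β : ℝ) (K j : ℕ) :
    (H.modStage r α β K j).passed = passedAll (H.modStat r α β K) (H.modThreshold r α β K) j := by
  induction j with
  | zero => simp [modStage, passedAll]
  | succ j ih =>
    rw [passedAll_succ, ← ih]
    cases j with
    | zero => simp [modStage, modStat, modThreshold]
    | succ j => rfl

lemma modStage_errors (hH : H.Regular) (r : ℕ) (hα : α ∈ Ioo (0 : ℝ) 1)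
    (hβ : β ∈ Ioo (0 : ℝ) 1) (hK : 1 ≤ K) {j : ℕ} (hj : 1 ≤ j) :
    (H.P 0).real (H.modStage r α β K j).passed ≤ (α ^ (1 / (K : ℝ))) ^ j ∧
      (H.P 1).real {ω | (H.modStat r α β K j ω : EReal) ≤ H.modThreshold r α β K j} ≤
        typeIILevel β K j := by
  have ha := rootLevel_mem hα hK
  match j, hj with
  | 1, _ =>
    have := cStar_spec hH ha.1 ha.2 (typeIILevel_pos hβ K 1)
    simpa [modStage, modStat, modThreshold, stSize, stThreshold] using this
  | j + 2, _ =>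
    rw [rootLevel_pow hα]
    have := sInf_modThresholds_spec (modSize_spec hH r (H.modStage r α β K (j + 1))
      (Real.rpow_pos_of_pos hα.1 (((j + 2 : ℕ) : ℝ) / K)) (typeIILevel_pos hβ K (j + 2)))
    rw [inter_comm] at this
    exact this

lemma modST_mem_testClass (hH : H.Regular) (r : ℕ) (hα : α ∈ Ioo (0 : ℝ) 1)
    (hβ : β ∈ Ioo (0 : ℝ) 1) (hK : 1 ≤ K) : H.modST r α β K ∈ H.testClass α β := by
  refine (adapted_modST hH r hα hβ hK).mem_testClass (b := H.modThreshold r α β K) ?_ ?_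
  · rw [← modStage_passed]
    exact (modStage_errors hH r hα hβ hK hK).1.trans (rootLevel_pow_self hα hK).le
  · refine le_trans (Finset.sum_le_sum fun j hj => ?_) (sum_typeIILevel β hK).le
    exact (modStage_errors hH r hα hβ hK (Finset.mem_Icc.1 hj).1).2

end ModST

/-! ### Bounds for the stage sizes -/

section Sizes

variable {r : ℕ} {α β : ℝ} {K : ℕ} {B c : ℝ}

/-- Every sample size `N ≥ j B` admits the threshold `c` at the error levels of stage `j`. -/
def SizeSuffices (H : SimpleTesting S) (α β : ℝ) (K : ℕ) (B c : ℝ) : Prop :=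
  ∀ j N : ℕ, 1 ≤ j → j * B ≤ N →
    (H.P 0).real {ω | c < H.avgLlr N ω} ≤ (α ^ (1 / (K : ℝ))) ^ j ∧
      (H.P 1).real {ω | H.avgLlr N ω ≤ c} ≤ (β / 2) ^ j

lemma SizeSuffices.stSize_le (h : H.SizeSuffices α β K B c) (hα : α ∈ Ioo (0 : ℝ) 1)
    (hβ : β ∈ Ioo (0 : ℝ) 1) (hK : 1 ≤ K) (hB : 1 ≤ B) {j : ℕ} (hj : 1 ≤ j) :
    H.stSize α β K j ≤ ⌈j * B⌉₊ := by
  have ha := rootLevel_mem hα hK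
  have hj' : (1 : ℝ) ≤ j := by exact_mod_cast hj
  obtain ⟨h1, h2⟩ := h j ⌈j * B⌉₊ hj (Nat.le_ceil _)
  refine nStar_le (c := c) (Nat.one_le_ceil_iff.2 (by positivity)) ⟨h1.trans ?_, h2.trans ?_⟩
  · exact pow_le_of_le_one ha.1.le ha.2.le (by omega)
  · exact half_pow_le_typeIILevel hβ K

lemma SizeSuffices.stTotal_le (h : H.SizeSuffices α β K B c) (hα : α ∈ Ioo (0 : ℝ) 1)
    (hβ : β ∈ Ioo (0 : ℝ) 1) (hK : 1 ≤ K) (hB : 1 ≤ B) (j : ℕ) :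
    (H.stTotal α β K j : ℝ) ≤ j * (j + 1) / 2 * (B + 1) := by
  induction j with
  | zero => simp [stTotal]
  | succ j ih =>
    have h1 : (H.stSize α β K (j + 1) : ℝ) ≤ (j + 1 : ℕ) * B + 1 :=
      (Nat.cast_le.2 (h.stSize_le hα hβ hK hB (Nat.le_add_left 1 j))).trans
        (Nat.ceil_lt_add_one (by positivity)).le
    rw [stTotal_succ]
    push_cast at h1 ⊢
    nlinarith [(Nat.cast_nonneg j : (0 : ℝ) ≤ j)]

lemma SizeSuffices.modStage_total_le (h : H.SizeSuffices α β K B c) (hr : r ≤ 1)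
    (hα : α ∈ Ioo (0 : ℝ) 1) (hβ : β ∈ Ioo (0 : ℝ) 1) (hK : 1 ≤ K) (hB : 1 ≤ B) (j : ℕ) :
    (H.modStage r α β K (j + 1)).total ≤ ⌈(j + 1 : ℕ) * B⌉₊ := by
  induction j with
  | zero => exact h.stSize_le hα hβ hK hB le_rfl
  | succ j ih =>
    obtain ⟨h1, h2⟩ := h (j + 2) ⌈(j + 2 : ℕ) * B⌉₊ (by omega) (Nat.le_ceil _)
    rw [rootLevel_pow hα] at h1
    refine modNext_total_le r (H.modStage r α β K (j + 1)) ?_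
      ⟨h1, h2.trans (half_pow_le_typeIILevel hβ K)⟩
    -- Because `B ≥ 1`, successive ceilings differ by at least one, which leaves room for the
    -- minimal stage size `r ≤ 1`.
    calc _ ≤ ⌈(j + 1 : ℕ) * B⌉₊ + 1 := add_le_add ih hr
      _ = ⌈(j + 1 : ℕ) * B + 1⌉₊ := (Nat.ceil_add_one (by positivity)).symm
      _ ≤ _ := by
        refine Nat.ceil_mono ?_
        push_cast
        linarith

lemma SizeSuffices.modStage_total_le' (h : H.SizeSuffices α β K B c) (hr : r ≤ 1)
    (hα : α ∈ Ioo (0 : ℝ) 1) (hβ : β ∈ Ioo (0 : ℝ) 1) (hK : 1 ≤ K) (hB : 1 ≤ B) {j : ℕ}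
    (hj : 1 ≤ j) : ((H.modStage r α β K j).total : ℝ) ≤ j * (B + 1) := by
  obtain ⟨j, rfl⟩ := Nat.exists_eq_succ_of_ne_zero (Nat.one_le_iff_ne_zero.1 hj)
  have := (Nat.cast_le (α := ℝ).2 (h.modStage_total_le hr hα hβ hK hB j)).trans
    (Nat.ceil_lt_add_one (by positivity)).le
  push_cast at this ⊢
  nlinarith [(Nat.cast_nonneg j : (0 : ℝ) ≤ j)]

lemma SizeSuffices.ess_zero_ST_le (h : H.SizeSuffices α β K B c) (hH : H.Regular)
    (hα : α ∈ Ioo (0 : ℝ) 1) (hβ : β ∈ Ioo (0 : ℝ) 1) (hK : 1 ≤ K) (hB : 1 ≤ B)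
    (ha : α ^ (1 / (K : ℝ)) ≤ 1 / 8) :
    H.ess 0 (H.ST α β K).1 ≤ ENNReal.ofReal ((B + 1) * (1 + 8 * α ^ (1 / (K : ℝ)))) := by
  refine (adapted_ST hH hα hβ hK).ess_zero_le (by linarith) (rootLevel_mem hα hK).1.le ha
    (fun j hj => ?_) fun j hj => P_zero_passedAll_ST_le hH hα hβ hK (Finset.mem_Icc.1 hj).2
  have hj' : (1 : ℝ) ≤ j := by exact_mod_cast (Finset.mem_Icc.1 hj).1
  refine (h.stTotal_le hα hβ hK hB j).trans ?_
  gcongr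
  nlinarith

lemma SizeSuffices.ess_zero_modST_le (h : H.SizeSuffices α β K B c) (hr : r ≤ 1) (hH : H.Regular)
    (hα : α ∈ Ioo (0 : ℝ) 1) (hβ : β ∈ Ioo (0 : ℝ) 1) (hK : 1 ≤ K) (hB : 1 ≤ B)
    (ha : α ^ (1 / (K : ℝ)) ≤ 1 / 8) :
    H.ess 0 (H.modST r α β K).1 ≤ ENNReal.ofReal ((B + 1) * (1 + 8 * α ^ (1 / (K : ℝ)))) := by
  refine (adapted_modST hH r hα hβ hK).ess_zero_le (b := H.modThreshold r α β K) (by linarith)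
    (rootLevel_mem hα hK).1.le ha (fun j hj => ?_) fun j hj => ?_
  · have hj' : (1 : ℝ) ≤ j := by exact_mod_cast (Finset.mem_Icc.1 hj).1
    refine (h.modStage_total_le' hr hα hβ hK hB (Finset.mem_Icc.1 hj).1).trans ?_
    gcongr
    nlinarith
  · rw [← modStage_passed]
    exact (modStage_errors hH r hα hβ hK (Finset.mem_Icc.1 hj).1).1

lemma SizeSuffices.ess_one_ST_le (h : H.SizeSuffices α β K B c) (hH : H.Regular)
    (hα : α ∈ Ioo (0 : ℝ) 1) (hβ : β ∈ Ioo (0 : ℝ) 1) (hK : 1 ≤ K) (hB : 1 ≤ B) :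
    H.ess 1 (H.ST α β K).1 ≤ ENNReal.ofReal (K * (K + 1) / 2 * (B + 1)) := by
  refine ((adapted_ST hH hα hβ hK).ess_le 1).trans ?_
  rw [← ENNReal.ofReal_natCast]
  exact ENNReal.ofReal_le_ofReal (h.stTotal_le hα hβ hK hB K)

lemma SizeSuffices.ess_one_modST_le (h : H.SizeSuffices α β K B c) (hr : r ≤ 1) (hH : H.Regular)
    (hα : α ∈ Ioo (0 : ℝ) 1) (hβ : β ∈ Ioo (0 : ℝ) 1) (hK : 1 ≤ K) (hB : 1 ≤ B) :
    H.ess 1 (H.modST r α β K).1 ≤ ENNReal.ofReal (K * (B + 1)) := by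
  refine ((adapted_modST hH r hα hβ hK).ess_le (b := H.modThreshold r α β K) 1).trans ?_
  rw [← ENNReal.ofReal_natCast]
  exact ENNReal.ofReal_le_ofReal (h.modStage_total_le' hr hα hβ hK hB hK)

end Sizes

/-! ### Lower bounds -/

/-- At type-II error levels below `η`, an event determined by at most `(1 - ε) |log δ| / I 0`
observations that has probability at most `δ` under the alternative has probability at most `ε`
under the null. -/
def ConverseAt (H : SimpleTesting S) (ε η : ℝ) : Prop :=
  ∀ δ ∈ Ioo 0 η, ∀ N : ℕ, N * H.I 0 ≤ (1 - ε) * -Real.log δ →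
    ∀ A, MeasurableSet[obs S N] A → (H.P 1).real A ≤ δ → (H.P 0).real A ≤ ε

lemma IsTest.measurableSet_le {T : (ℕ → S) → ℕ∞} {D : (ℕ → S) → Fin 2} (h : H.IsTest T D) (N : ℕ) :
    MeasurableSet[obs S N] {ω | T ω ≤ N ∧ D ω = 0} := by
  have : {ω | T ω ≤ N ∧ D ω = 0} = ⋃ n ∈ Finset.Icc 1 N, {ω | T ω = n ∧ D ω = 0} := by
    ext ω
    simp only [mem_ofPred_eq, mem_iUnion, Finset.mem_Icc, exists_prop]
    constructor
    · rintro ⟨h1, h2⟩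
      obtain ⟨n, hn⟩ := ENat.ne_top_iff_exists.1 (ne_top_of_le_ne_top (ENat.natCast_ne_top N) h1)
      have h3 := h.one_le ω
      rw [← hn] at h1 h3
      exact ⟨n, ⟨by exact_mod_cast h3, by exact_mod_cast h1⟩, hn.symm, h2⟩
    · rintro ⟨n, hn, h1, h2⟩
      exact ⟨by rw [h1]; exact_mod_cast hn.2, h2⟩
  rw [this]
  refine Finset.measurableSet_biUnion _ fun n hn => ?_
  rw [Finset.mem_Icc] at hn
  exact obs_mono hn.2 _ (h.decision n hn.1 0)

/-- Under the null, accepting by time `N` has probability at most `ε` by the converse, and rejecting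
at any time at most `α ≤ ε`. Otherwise at least `N + 1` observations are taken. -/
lemma ConverseAt.le_optEss {ε η α β : ℝ} (h : H.ConverseAt ε η) (hI : 0 < H.I 0) (hε1 : ε < 1 / 2)
    (hη : η < 1) (hα : α ≤ ε) (hβ : β ∈ Ioo 0 η) :
    ENNReal.ofReal ((1 - 2 * ε) * ((1 - ε) * (-Real.log β / H.I 0))) ≤ H.optEss 0 α β := by
  refine le_iInf₂ fun χ hχ => ?_
  obtain ⟨htest, h0, h1⟩ := hχ
  set N := ⌊(1 - ε) * (-Real.log β / H.I 0)⌋₊ with hN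
  have hL : 0 < -Real.log β := neg_pos.2 (Real.log_neg hβ.1 (hβ.2.trans hη))
  have hpos : 0 ≤ (1 - ε) * (-Real.log β / H.I 0) :=
    mul_nonneg (by linarith) (div_pos hL hI).le
  have hNle : N * H.I 0 ≤ (1 - ε) * -Real.log β := by
    have := Nat.floor_le hpos
    rwa [← hN, ← mul_div_assoc, le_div_iff₀ hI] at this
  have hA := h β hβ N hNle _ (htest.measurableSet_le N)
    ((measureReal_mono fun ω hω => hω.2).trans h1)
  have hAm := obs_le _ _ (htest.measurableSet_le N)
  have hDm : MeasurableSet {ω | χ.2 ω = 1} := htest.measurable_decision (measurableSet_singleton 1)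
  set E := ({ω | χ.1 ω ≤ N ∧ χ.2 ω = 0} ∪ {ω | χ.2 ω = 1})ᶜ with hE
  have hEm : MeasurableSet E := (hAm.union hDm).compl
  have hPE : 1 - 2 * ε ≤ (H.P 0).real E := by
    rw [hE, probReal_compl_eq_one_sub (hAm.union hDm)]
    have := measureReal_union_le (μ := H.P 0) {ω | χ.1 ω ≤ N ∧ χ.2 ω = 0} {ω | χ.2 ω = 1}
    linarith
  calc _ ≤ ENNReal.ofReal ((H.P 0).real E * (N + 1)) := by
        refine ENNReal.ofReal_le_ofReal ?_
        have := (Nat.lt_floor_add_one ((1 - ε) * (-Real.log β / H.I 0))).le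
        exact mul_le_mul hPE this hpos measureReal_nonneg
    _ = ((N + 1 : ℕ) : ℝ≥0∞) * H.P 0 E := by
        rw [ENNReal.ofReal_mul measureReal_nonneg, ofReal_measureReal, mul_comm,
          ← ENNReal.ofReal_natCast, Nat.cast_add_one]
    _ = ∫⁻ ω, E.indicator (fun _ => ((N + 1 : ℕ) : ℝ≥0∞)) ω ∂(H.P 0) := by
        rw [lintegral_indicator_const hEm]
    _ ≤ H.ess 0 χ.1 := by
        refine lintegral_mono fun ω => indicator_apply_le' (fun hω => ?_) fun _ => zero_le
        have hlt : (N : ℕ∞) < χ.1 ω := by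
          by_contra! hle
          refine hω ?_
          by_cases hD : χ.2 ω = 1
          · exact Or.inr hD
          · exact Or.inl ⟨hle, by omega⟩
        have : ((N + 1 : ℕ) : ℕ∞) ≤ χ.1 ω := by
          push_cast
          exact Order.add_one_le_of_lt hlt
        simpa only [ENat.toENNReal_coe] using ENat.toENNReal_le.2 this

/-- With a smaller sample, the acceptance region would have `P 0`-probability at most `ε`, forcing a
type-I error of at least `1 - ε > a`. -/
lemma ConverseAt.lt_nStar {ε η a δ : ℝ} (h : H.ConverseAt ε η) (hH : H.Regular) (ha : 0 < a)
    (ha' : a < 1 - ε) (hδ : δ ∈ Ioo 0 η) :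
    (1 - ε) * -Real.log δ < H.nStar a δ * H.I 0 := by
  by_contra! hle
  obtain ⟨-, c, h0, h1⟩ := exists_nStar hH ha hδ.1
  have := h δ hδ _ hle {ω | H.avgLlr (H.nStar a δ) ω ≤ c}
    (H.measurable_avgLlr_obs _ measurableSet_Iic) h1
  have hcompl : {ω | c < H.avgLlr (H.nStar a δ) ω} = {ω | H.avgLlr (H.nStar a δ) ω ≤ c}ᶜ := by
    ext ω
    simp
  rw [hcompl, probReal_compl_eq_one_sub
    (measurableSet_le (H.measurable_avgLlr _) measurable_const)] at h0
  linarith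

lemma ConverseAt.le_stTotal {ε η α β : ℝ} {K : ℕ} (h : H.ConverseAt ε η) (hH : H.Regular)
    (hε1 : ε < 1) (hα : α ∈ Ioo (0 : ℝ) 1) (hK : 1 ≤ K) (ha : α ^ (1 / (K : ℝ)) < 1 - ε)
    (hβ : β ∈ Ioo (0 : ℝ) 1) (hβη : β < η) (j : ℕ) :
    (1 - ε) * (j * (j + 1) / 2 * (-Real.log β / H.I 0)) ≤ H.stTotal α β K j := by
  have hI := hH.I_pos
  induction j with
  | zero => simp
  | succ j ih =>
    have hle := typeIILevel_le_pow hβ K (j + 1)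
    have hpos := typeIILevel_pos hβ K (j + 1)
    have hlt := h.lt_nStar hH (rootLevel_mem hα hK).1 ha ⟨hpos,
      (hle.trans (pow_le_of_le_one hβ.1.le hβ.2.le (by omega))).trans_lt hβη⟩
    have hlog := Real.log_le_log hpos hle
    rw [Real.log_pow] at hlog
    have hsize : (1 - ε) * ((j + 1 : ℕ) * (-Real.log β / H.I 0)) ≤ H.stSize α β K (j + 1) := by
      rw [← mul_div_assoc, ← mul_div_assoc, div_le_iff₀ hI]
      refine le_trans (mul_le_mul_of_nonneg_left ?_ (by linarith)) hlt.le
      linarith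
    rw [stTotal_succ]
    push_cast at hsize ⊢
    linarith

/-- Rejection requires passing all stages, so under the alternative ST runs through all `M_K`
observations with probability at least `1 - β`. -/
lemma ConverseAt.le_ess_one_ST {ε η α β : ℝ} {K : ℕ} (h : H.ConverseAt ε η) (hH : H.Regular)
    (hε1 : ε < 1) (hα : α ∈ Ioo (0 : ℝ) 1) (hK : 1 ≤ K) (ha : α ^ (1 / (K : ℝ)) < 1 - ε)
    (hβ : β ∈ Ioo (0 : ℝ) 1) (hβη : β < η) :
    ENNReal.ofReal ((1 - ε) * (K * (K + 1) / 2 * (-Real.log β / H.I 0)) * (1 - β)) ≤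
      H.ess 1 (H.ST α β K).1 := by
  have had := adapted_ST hH hα hβ hK
  have hm := had.measurableSet_passedAll' (b := fun j => (H.stThreshold α β K j : EReal)) (le_refl K)
  refine le_trans ?_ (had.le_ess (b := fun j => (H.stThreshold α β K j : EReal)) 1)
  have hP : 1 - β ≤ (H.P 1).real
      (passedAll (H.stStat α β K) (fun j => (H.stThreshold α β K j : EReal)) K) := by
    have h2 := (ST_mem_testClass hH hα hβ hK).2.2
    have h3 : {ω | (H.ST α β K).2 ω = 0} =
        (passedAll (H.stStat α β K) (fun j => (H.stThreshold α β K j : EReal)) K)ᶜ := by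
      ext ω
      exact stagedTest_snd_eq_zero_iff ω
    rw [h3, probReal_compl_eq_one_sub hm] at h2
    linarith
  rw [← ofReal_measureReal, ← ENNReal.ofReal_natCast, ← ENNReal.ofReal_mul (Nat.cast_nonneg _)]
  refine ENNReal.ofReal_le_ofReal ?_
  exact mul_le_mul (h.le_stTotal hH hε1 hα hK ha hβ hβη K) hP (by linarith [hβ.2])
    (Nat.cast_nonneg _)

/-! ### An upper bound for the optimal expected sample size under the alternative -/

lemma isTest_twoStage {n₁ n₂ : ℕ} (h₁ : 1 ≤ n₁) (h₁₂ : n₁ ≤ n₂) {A B : Set (ℕ → S)}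
    [DecidablePred (· ∈ A)] [DecidablePred (· ∈ A ∪ B)]
    (hA : MeasurableSet[obs S n₁] A) (hB : MeasurableSet[obs S n₂] B) :
    H.IsTest (fun ω => if ω ∈ A then (n₁ : ℕ∞) else n₂) (fun ω => if ω ∈ A ∪ B then 1 else 0) := by
  have hA2 := obs_mono h₁₂ A hA
  -- The condition `m = n` is void or contradictory, which transfers measurability between the two
  -- indices.
  have hconst : ∀ {m n : ℕ} {E : Set (ℕ → S)}, MeasurableSet[obs S m] E →
      MeasurableSet[obs S n] (E ∩ {_ω | m = n}) := by
    intro m n E hE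
    by_cases hmn : m = n
    · subst hmn
      simpa using hE
    · simp [hmn]
  refine ⟨fun ω => ?_, fun i => .of_forall fun ω => ?_, fun n _ => ?_, ?_, fun n _ i => ?_⟩
  · split_ifs
    · exact_mod_cast h₁
    · exact_mod_cast h₁.trans h₁₂
  · split_ifs <;> exact ENat.natCast_ne_top _
  · convert (hconst (n := n) hA).union (hconst (n := n) hA2.compl) using 1
    ext ω
    by_cases hω : ω ∈ A <;> simp [hω]
  · exact Measurable.ite (obs_le _ _ (hA2.union hB)) measurable_const measurable_const
  · fin_cases i
    · convert hconst (n := n) (hA2.compl.inter hB.compl) using 1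
      ext ω
      by_cases hω : ω ∈ A <;> by_cases hω' : ω ∈ B <;> simp [hω, hω']
    · convert (hconst (n := n) hA).union (hconst (n := n) (hA2.compl.inter hB)) using 1
      ext ω
      by_cases hω : ω ∈ A <;> by_cases hω' : ω ∈ B <;> simp [hω, hω']

/-- A test that may reject after about `C |log α|` observations and otherwise continues to `n₂`. The
factor `α` on `|log β|` is essential: for bounded `K`, a fixed multiple of `|log β|` would not be `≪
K |log β|`. -/
lemma exists_optEss_one_le (hH : H.Regular) : ∃ C > 0, ∀ α ∈ Ioo (0 : ℝ) 1, ∀ β ∈ Ioo (0 : ℝ) 1,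
    H.optEss 1 α β ≤ ENNReal.ofReal
      (C * (1 + -Real.log α) + α * (C * (1 + -Real.log α + -Real.log β))) := by
  classical
  have hI := hH.I_pos
  obtain ⟨ρ, hρ, c, h⟩ := exists_errors_le hH (half_lt_self hI)
  set C := max (1 / ρ) (2 / H.I 0) with hC
  have hC0 : 0 < C := lt_max_of_lt_left (by positivity)
  have hCρ : ∀ x : ℝ, ∀ n : ℕ, 0 ≤ x → C * x ≤ n → x ≤ ρ * n := by
    intro x n hx hn
    have : 1 / ρ * x ≤ n := le_trans (by gcongr; exact le_max_left _ _) hn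
    rw [one_div, inv_mul_le_iff₀ hρ] at this
    linarith
  have hCI : ∀ x : ℝ, ∀ n : ℕ, 0 ≤ x → C * x ≤ n → x ≤ H.I 0 / 2 * n := by
    intro x n hx hn
    have : 2 / H.I 0 * x ≤ n := le_trans (by gcongr; exact le_max_right _ _) hn
    rw [div_mul_eq_mul_div, div_le_iff₀ hI] at this
    linarith
  refine ⟨C + 1, by positivity, fun α hα β hβ => ?_⟩
  have hLα : 0 < -Real.log α := neg_pos.2 (Real.log_neg hα.1 hα.2)
  have hLβ : 0 < -Real.log β := neg_pos.2 (Real.log_neg hβ.1 hβ.2)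
  have hlog2 : 0 < Real.log 2 := Real.log_pos one_lt_two
  have hlog2' : Real.log 2 < 0.6931471808 := Real.log_two_lt_d9
  have hhalf : -Real.log (α / 2) = -Real.log α + Real.log 2 := by
    rw [Real.log_div hα.1.ne' two_ne_zero]
    ring
  set n₁ := ⌈C * (-Real.log α + Real.log 2)⌉₊ with hn₁
  set n₂ := ⌈C * (-Real.log α + -Real.log β + Real.log 2)⌉₊ with hn₂
  have h1 : 1 ≤ n₁ := Nat.one_le_ceil_iff.2 (by positivity)
  have h12 : n₁ ≤ n₂ := Nat.ceil_mono (by gcongr; linarith)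
  have hn₁' : C * (-Real.log α + Real.log 2) ≤ n₁ := Nat.le_ceil _
  have hn₂' : C * (-Real.log α + -Real.log β + Real.log 2) ≤ n₂ := Nat.le_ceil _
  have hmono : ∀ x y : ℝ, x ≤ y → C * x ≤ C * y := fun x y hxy =>
    mul_le_mul_of_nonneg_left hxy hC0.le
  -- The type-I budget is shared equally by the two stages. The first stage takes type-II level `α`,
  -- so the second is needed with `P 1`-probability at most `α`; only the second must meet `β`.
  have e1 := h n₁ (α / 2) α (half_pos hα.1) hα.1
    (by rw [hhalf]; exact hCρ _ _ (by positivity) hn₁')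
    (hCI _ _ hLα.le ((hmono _ _ (by linarith)).trans hn₁'))
  have e2 := h n₂ (α / 2) β (half_pos hα.1) hβ.1
    (by rw [hhalf]; exact hCρ _ _ (by positivity) ((hmono _ _ (by linarith)).trans hn₂'))
    (hCI _ _ hLβ.le ((hmono _ _ (by linarith)).trans hn₂'))
  set A : Set (ℕ → S) := {ω | c < H.avgLlr n₁ ω} with hA
  set B : Set (ℕ → S) := {ω | c < H.avgLlr n₂ ω} with hB
  have hAm : MeasurableSet[obs S n₁] A := H.measurable_avgLlr_obs n₁ measurableSet_Ioi
  have hBm : MeasurableSet[obs S n₂] B := H.measurable_avgLlr_obs n₂ measurableSet_Ioi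
  have htest := isTest_twoStage (H := H) h1 h12 hAm hBm
  have hmem : ((fun ω => if ω ∈ A then (n₁ : ℕ∞) else n₂),
      (fun ω => if ω ∈ A ∪ B then (1 : Fin 2) else 0)) ∈ H.testClass α β := by
    refine ⟨htest, ?_, ?_⟩
    · calc _ ≤ (H.P 0).real (A ∪ B) := measureReal_mono fun ω hω => 
            or_iff_not_imp_left.2 (by simpa using hω)
        _ ≤ _ := measureReal_union_le _ _
        _ ≤ α := by linarith [e1.1, e2.1]
    · refine (measureReal_mono fun ω hω => ?_).trans e2.2
      have : ¬ (ω ∈ A ∨ ω ∈ B) := by simpa using hω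
      simpa [hB] using fun hlt => this (Or.inr hlt)
  refine (iInf₂_le _ hmem).trans ?_
  have hAm' := obs_le _ _ hAm
  calc _ ≤ ∫⁻ ω, ((n₁ : ℝ≥0∞) + Aᶜ.indicator (fun _ => (n₂ : ℝ≥0∞)) ω) ∂(H.P 1) := by
        refine lintegral_mono fun ω => ?_
        by_cases hω : ω ∈ A <;> simp [hω]
    _ = n₁ + n₂ * H.P 1 Aᶜ := by
        rw [lintegral_add_left measurable_const, lintegral_indicator_const hAm'.compl]
        simp
    _ ≤ ENNReal.ofReal (n₁ + α * n₂) := by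
        rw [ENNReal.ofReal_add (Nat.cast_nonneg _) (mul_nonneg hα.1.le (Nat.cast_nonneg _)),
          ENNReal.ofReal_natCast, ENNReal.ofReal_mul hα.1.le, ENNReal.ofReal_natCast,
          mul_comm (n₂ : ℝ≥0∞), ← ofReal_measureReal]
        gcongr
        refine le_trans (measureReal_mono fun ω hω => ?_) e1.2
        simpa [hA] using hω
    _ ≤ _ := by
        refine ENNReal.ofReal_le_ofReal ?_
        have b1 := (Nat.ceil_lt_add_one (a := C * (-Real.log α + Real.log 2)) (by positivity)).le
        have b2 := (Nat.ceil_lt_add_one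
          (a := C * (-Real.log α + -Real.log β + Real.log 2)) (by positivity)).le
        rw [← hn₁] at b1
        rw [← hn₂] at b2
        have hα0 := hα.1.le
        refine add_le_add ?_ (mul_le_mul_of_nonneg_left ?_ hα0) <;> nlinarith

end SimpleTesting

/-! ### Asymptotic relations -/

section Asymptotics

variable {ι : Type*} {l : Filter ι} {x y : ι → ℝ≥0∞} {u : ι → ℝ}

lemma asympEquiv_of_bounds (hu : ∀ᶠ p in l, 0 < u p)
    (h : ∀ ε ∈ Ioo (0 : ℝ) 1, ∀ᶠ p in l, ENNReal.ofReal ((1 - ε) * u p) ≤ x p ∧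
      x p ≤ ENNReal.ofReal ((1 + ε) * u p)) :
    AsympEquiv l x fun p => ENNReal.ofReal (u p) := by
  refine (ENNReal.tendsto_nhds ENNReal.one_ne_top).2 fun e he => ?_
  obtain ⟨ε, hε0, hε⟩ := ENNReal.lt_iff_exists_nnreal_btwn.1 (lt_min he one_pos)
  have hε0' : (0 : ℝ) < ε := by exact_mod_cast hε0
  have hε1 : (ε : ℝ) < 1 := by
    have := hε.trans_le (min_le_right _ _)
    exact_mod_cast this
  have hεe : ENNReal.ofReal ε ≤ e := by
    rw [ENNReal.ofReal_coe_nnreal]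
    exact (hε.trans_le (min_le_left _ _)).le
  filter_upwards [hu, h ε ⟨hε0', hε1⟩] with p hp ⟨h1, h2⟩
  have hU0 : ENNReal.ofReal (u p) ≠ 0 := by simpa using hp
  rw [ENNReal.ofReal_mul (by linarith)] at h1 h2
  constructor
  · rw [ENNReal.le_div_iff_mul_le (Or.inl hU0) (Or.inl ENNReal.ofReal_ne_top)]
    refine le_trans (mul_le_mul' ?_ le_rfl) h1
    rw [ENNReal.ofReal_sub _ hε0'.le, ENNReal.ofReal_one]
    exact tsub_le_tsub_left hεe 1
  · rw [ENNReal.div_le_iff_le_mul (Or.inl hU0) (Or.inl ENNReal.ofReal_ne_top)]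
    refine h2.trans (mul_le_mul' ?_ le_rfl)
    rw [ENNReal.ofReal_add zero_le_one hε0'.le, ENNReal.ofReal_one]
    gcongr

lemma AsympEquiv.symm_ofReal (hu : ∀ᶠ p in l, 0 < u p)
    (h : AsympEquiv l x fun p => ENNReal.ofReal (u p)) :
    AsympEquiv l (fun p => ENNReal.ofReal (u p)) x := by
  have := tendsto_inv_iff.2 h
  rw [inv_one] at this
  refine this.congr' ?_
  filter_upwards [hu] with p hp
  exact ENNReal.inv_div (Or.inl ENNReal.ofReal_ne_top) (Or.inl (by simpa using hp))

lemma AsympEquiv.of_ofReal (hu : ∀ᶠ p in l, 0 < u p)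
    (hx : AsympEquiv l x fun p => ENNReal.ofReal (u p))
    (hy : AsympEquiv l y fun p => ENNReal.ofReal (u p)) : AsympEquiv l x y := by
  have := ENNReal.Tendsto.mul hx (Or.inl one_ne_zero) (hy.symm_ofReal hu) (Or.inl one_ne_zero)
  rw [one_mul] at this
  refine this.congr' ?_
  filter_upwards [hu] with p hp
  rw [div_eq_mul_inv, div_eq_mul_inv, div_eq_mul_inv, mul_assoc,
    ← mul_assoc _ _ (y p)⁻¹, ENNReal.inv_mul_cancel (by simpa using hp) ENNReal.ofReal_ne_top,
    one_mul]

lemma asympLE_of_bounds (h : ∀ ε ∈ Ioo (0 : ℝ) 1, ∀ᶠ p in l,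
    x p ≤ ENNReal.ofReal ((1 + ε) * u p)) : AsympLE l x fun p => ENNReal.ofReal (u p) := by
  refine ENNReal.le_of_forall_pos_le_add fun e he _ => ?_
  set ε : ℝ := min e (1 / 2)
  have hε : ε ∈ Ioo (0 : ℝ) 1 := ⟨by positivity, (min_le_right _ _).trans_lt (by norm_num)⟩
  refine limsup_le_of_le (by isBoundedDefault) ?_
  filter_upwards [h ε hε] with p hp
  refine ENNReal.div_le_of_le_mul (hp.trans ?_)
  rw [ENNReal.ofReal_mul (by linarith [hε.1]), ENNReal.ofReal_add zero_le_one hε.1.le,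
    ENNReal.ofReal_one]
  gcongr
  rw [← ENNReal.ofReal_coe_nnreal]
  exact ENNReal.ofReal_le_ofReal (min_le_left _ _)

lemma muchGreater_of_bounds {v : ι → ℝ} (hu : ∀ᶠ p in l, 0 < u p) (hv : ∀ᶠ p in l, 0 < v p)
    (h : ∀ ε > 0, ∀ᶠ p in l, y p ≤ ENNReal.ofReal (ε * u p)) :
    MuchGreater l (fun p => ENNReal.ofReal (v p * u p)) fun p => ENNReal.ofReal (v p) * y p := by
  refine ENNReal.tendsto_nhds_top fun n => ?_
  filter_upwards [hu, hv, h (1 / (n + 1)) (by positivity)] with p hup hvp hp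
  have hpos : 0 < v p * (1 / (n + 1) * u p) := by positivity
  calc (n : ℝ≥0∞) < ENNReal.ofReal (n + 1) := by
        rw [← ENNReal.ofReal_natCast, ENNReal.ofReal_lt_ofReal_iff (by positivity)]
        linarith
    _ = ENNReal.ofReal (v p * u p) / ENNReal.ofReal (v p * (1 / (n + 1) * u p)) := by
        rw [← ENNReal.ofReal_div_of_pos hpos]
        congr 1
        field_simp
    _ ≤ _ := by
        refine ENNReal.div_le_div_left ?_ _
        rw [ENNReal.ofReal_mul hvp.le]
        gcongr

end Asymptotics

namespace SimpleTesting
variable {S : Type*} [MeasurableSpace S] {H : SimpleTesting S}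

/-! ### The regime of small errors -/

lemma tendsto_fst_smallErrors : Tendsto Prod.fst smallErrors (𝓝[>] (0 : ℝ)) := tendsto_fst

lemma tendsto_snd_smallErrors : Tendsto Prod.snd smallErrors (𝓝[>] (0 : ℝ)) := tendsto_snd

lemma eventually_fst_mem {η : ℝ} (hη : 0 < η) : ∀ᶠ p in smallErrors, p.1 ∈ Ioo 0 η :=
  tendsto_fst_smallErrors.eventually (Ioo_mem_nhdsGT hη)

lemma eventually_snd_mem {η : ℝ} (hη : 0 < η) : ∀ᶠ p in smallErrors, p.2 ∈ Ioo 0 η :=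
  tendsto_snd_smallErrors.eventually (Ioo_mem_nhdsGT hη)

lemma eventually_le_neg_log (C : ℝ) : ∀ᶠ p in smallErrors, C ≤ -Real.log p.2 :=
  (tendsto_neg_atBot_atTop.comp
    (Real.tendsto_log_nhdsGT_zero.comp tendsto_snd_smallErrors)).eventually_ge_atTop C

lemma abs_log_eq {x : ℝ} (hx : x ∈ Ioo (0 : ℝ) 1) : |Real.log x| = -Real.log x :=
  abs_of_neg (Real.log_neg hx.1 hx.2)

variable {K : ℝ → ℝ → ℕ}

lemma eventually_regime (hK : ∀ α ∈ Ioo (0 : ℝ) 1, ∀ β ∈ Ioo (0 : ℝ) 1, 1 ≤ K α β) :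
    ∀ᶠ p in smallErrors, p.1 ∈ Ioo (0 : ℝ) 1 ∧ p.2 ∈ Ioo (0 : ℝ) 1 ∧
    1 ≤ K p.1 p.2 := by
  filter_upwards [eventually_fst_mem one_pos, eventually_snd_mem one_pos] with p h1 h2
  exact ⟨h1, h2, hK _ h1 _ h2⟩

lemma tendsto_rootLevel_iff (hK : ∀ α ∈ Ioo (0 : ℝ) 1, ∀ β ∈ Ioo (0 : ℝ) 1, 1 ≤ K α β) :
    Tendsto (fun p : ℝ × ℝ => p.1 ^ (1 / (K p.1 p.2 : ℝ))) smallErrors (𝓝 0) ↔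
      MuchLess smallErrors (fun p => (K p.1 p.2 : ℝ)) (fun p => |Real.log p.1|) := by
  have hreg := eventually_regime hK
  have hlog : ∀ᶠ p in smallErrors, (K p.1 p.2 : ℝ) / |Real.log p.1| =
      (-Real.log (p.1 ^ (1 / (K p.1 p.2 : ℝ))))⁻¹ := by
    filter_upwards [hreg] with p ⟨h1, _, _⟩
    rw [abs_log_eq h1, Real.log_rpow h1.1, ← mul_neg, mul_inv, one_div, inv_inv, div_eq_mul_inv]
  constructor
  · intro h
    have h' : Tendsto (fun p : ℝ × ℝ => p.1 ^ (1 / (K p.1 p.2 : ℝ))) smallErrors (𝓝[>] 0) :=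
      tendsto_nhdsWithin_iff.2 ⟨h, by
        filter_upwards [hreg] with p ⟨h1, _, h3⟩
        exact (rootLevel_mem h1 h3).1⟩
    refine Tendsto.congr' (EventuallyEq.symm hlog) ?_
    exact tendsto_inv_atTop_zero.comp
      (tendsto_neg_atBot_atTop.comp (Real.tendsto_log_nhdsGT_zero.comp h'))
  · intro h
    have h' : Tendsto (fun p : ℝ × ℝ => (-Real.log (p.1 ^ (1 / (K p.1 p.2 : ℝ))))⁻¹) smallErrors
        (𝓝[>] 0) := by
      refine tendsto_nhdsWithin_iff.2 ⟨h.congr' hlog, ?_⟩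
      filter_upwards [hreg] with p ⟨h1, _, h3⟩
      obtain ⟨g1, g2⟩ := rootLevel_mem h1 h3
      exact inv_pos.2 (neg_pos.2 (Real.log_neg g1 g2))
    have h2 := Real.tendsto_exp_neg_atTop_nhds_zero.comp (tendsto_inv_nhdsGT_zero.comp h')
    refine h2.congr' ?_
    filter_upwards [hreg] with p ⟨h1, _, h3⟩
    simp only [Function.comp_apply, inv_inv, neg_neg]
    exact Real.exp_log (rootLevel_mem h1 h3).1

lemma muchLess_log_rootLevel_iff
    (hK : ∀ α ∈ Ioo (0 : ℝ) 1, ∀ β ∈ Ioo (0 : ℝ) 1, 1 ≤ K α β) :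
    MuchLess smallErrors (fun p => |Real.log (p.1 ^ (1 / (K p.1 p.2 : ℝ)))|)
        (fun p => |Real.log p.2|) ↔
      MuchLess smallErrors (fun p => |Real.log p.1| / |Real.log p.2|)
        (fun p => (K p.1 p.2 : ℝ)) := by
  refine tendsto_congr' ?_
  filter_upwards [eventually_regime hK] with p ⟨h1, _, h3⟩
  rw [Real.log_rpow h1.1, abs_mul, abs_of_nonneg (by positivity : 0 ≤ 1 / (K p.1 p.2 : ℝ))]
  ring

/-- The type-II constraint alone fixes `B = |log (β / 2)| / κ`; the type-I constraint then holds
once `|log a| ≤ (ρ / κ) |log β|`. Both scale linearly in `j`, so "eventually" does not depend on the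
stage. -/
lemma eventually_sizeSuffices (hH : H.Regular)
    (hK : ∀ α ∈ Ioo (0 : ℝ) 1, ∀ β ∈ Ioo (0 : ℝ) 1, 1 ≤ K α β)
    (hlog : MuchLess smallErrors (fun p => |Real.log (p.1 ^ (1 / (K p.1 p.2 : ℝ)))|)
      (fun p => |Real.log p.2|)) {ε : ℝ} (hε : 0 < ε) :
    ∀ᶠ p in smallErrors, ∃ B c : ℝ, 1 ≤ B ∧ H.SizeSuffices p.1 p.2 (K p.1 p.2) B c ∧
      B + 1 ≤ (1 + ε) * (-Real.log p.2 / H.I 0) := by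
  have hI := hH.I_pos
  set κ := H.I 0 / (1 + ε / 2) with hκ
  have hκ0 : 0 < κ := by positivity
  obtain ⟨ρ, hρ, c, h⟩ := exists_errors_le hH (κ := κ) (div_lt_self hI (by linarith))
  have hlog2 : 0 < Real.log 2 := Real.log_pos one_lt_two
  -- The first bound on `|log β|` gives `B ≥ 1`; the second absorbs `log 2` and the `+ 1` into the
  -- remaining `ε / 2`.
  filter_upwards [eventually_regime hK, hlog.eventually_lt_const (div_pos hρ hκ0),
    eventually_le_neg_log κ, eventually_le_neg_log (((1 + ε / 2) * Real.log 2 + H.I 0) / (ε / 2))]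
    with p ⟨h1, h2, h3⟩ g1 g2 g3
  obtain ⟨ha0, ha1⟩ := rootLevel_mem h1 h3
  have hL : 0 < -Real.log p.2 := neg_pos.2 (Real.log_neg h2.1 h2.2)
  have hhalf : -Real.log (p.2 / 2) = -Real.log p.2 + Real.log 2 := by
    rw [Real.log_div h2.1.ne' two_ne_zero]
    ring
  rw [abs_log_eq ⟨ha0, ha1⟩, abs_log_eq h2, div_lt_iff₀ hL] at g1
  refine ⟨-Real.log (p.2 / 2) / κ, c, ?_, fun j N hj hN => ?_, ?_⟩
  · rw [one_le_div hκ0, hhalf]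
    linarith
  · have hj0 : (0 : ℝ) ≤ j := Nat.cast_nonneg j
    rw [← mul_div_assoc, div_le_iff₀ hκ0] at hN
    refine h N _ _ (pow_pos ha0 j) (pow_pos (half_pos h2.1) j) ?_ ?_
    · rw [Real.log_pow]
      have e1 : j * (ρ / κ * -Real.log p.2) ≤ ρ / κ * (N * κ) := by
        rw [mul_left_comm]
        refine mul_le_mul_of_nonneg_left (le_trans ?_ hN) (by positivity)
        rw [hhalf]
        exact mul_le_mul_of_nonneg_left (by linarith) hj0
      have e2 : ρ / κ * (N * κ) = ρ * N := by field_simp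
      nlinarith
    · rw [Real.log_pow]
      linarith
  · rw [div_le_iff₀ (by positivity)] at g3
    have e : (-Real.log (p.2 / 2) / κ + 1) * H.I 0 =
        (1 + ε / 2) * (-Real.log p.2 + Real.log 2) + H.I 0 := by
      rw [hhalf, hκ]
      field_simp
    rw [← mul_div_assoc, le_div_iff₀ hI, e]
    linarith

variable {r : ℕ}

/-! ### Asymptotics of the expected sample sizes -/

lemma eventually_pos_log_div (hI : 0 < H.I 0) :
    ∀ᶠ p in smallErrors, 0 < |Real.log p.2| / H.I 0 := by
  filter_upwards [eventually_snd_mem one_pos] with p hp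
  rw [abs_log_eq hp]
  exact div_pos (neg_pos.2 (Real.log_neg hp.1 hp.2)) hI

lemma eventually_le_optEss_zero (hH : H.Regular) {ε : ℝ} (hε : ε ∈ Ioo (0 : ℝ) 1) :
    ∀ᶠ p in smallErrors,
      ENNReal.ofReal ((1 - ε) * (|Real.log p.2| / H.I 0)) ≤ H.optEss 0 p.1 p.2 := by
  have hI := hH.I_pos
  obtain ⟨h0, h1⟩ := hε
  obtain ⟨η, hη, hη1, h⟩ := exists_P_zero_le hH (ε := ε / 3) (by linarith) (by linarith)
  have h : H.ConverseAt (ε / 3) η := h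
  filter_upwards [eventually_fst_mem (by linarith : 0 < ε / 3), eventually_snd_mem hη,
    eventually_pos_log_div hI] with p hp1 hp2 hu
  refine le_trans (ENNReal.ofReal_le_ofReal ?_)
    (h.le_optEss hI (by linarith) hη1 hp1.2.le hp2)
  rw [abs_log_eq ⟨hp2.1, hp2.2.trans hη1⟩] at hu ⊢
  rw [← mul_assoc]
  refine mul_le_mul_of_nonneg_right ?_ hu.le
  nlinarith

lemma asympOptimalNull_of_sizeSuffices (hH : H.Regular)
    (hK : ∀ α ∈ Ioo (0 : ℝ) 1, ∀ β ∈ Ioo (0 : ℝ) 1, 1 ≤ K α β)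
    (ha : Tendsto (fun p : ℝ × ℝ => p.1 ^ (1 / (K p.1 p.2 : ℝ))) smallErrors (𝓝 0))
    (hlog : MuchLess smallErrors (fun p => |Real.log (p.1 ^ (1 / (K p.1 p.2 : ℝ)))|)
      (fun p => |Real.log p.2|))
    {χ : ℝ → ℝ → ((ℕ → S) → ℕ∞) × ((ℕ → S) → Fin 2)}
    (hχ : ∀ α ∈ Ioo (0 : ℝ) 1, ∀ β ∈ Ioo (0 : ℝ) 1, χ α β ∈ H.testClass α β)
    (hle : ∀ α ∈ Ioo (0 : ℝ) 1, ∀ β ∈ Ioo (0 : ℝ) 1, ∀ B c : ℝ, 1 ≤ B →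
      H.SizeSuffices α β (K α β) B c → α ^ (1 / (K α β : ℝ)) ≤ 1 / 8 →
      H.ess 0 (χ α β).1 ≤ ENNReal.ofReal ((B + 1) * (1 + 8 * α ^ (1 / (K α β : ℝ))))) :
    H.AsympOptimalNull χ := by
  have hI := hH.I_pos
  have hu := eventually_pos_log_div hI
  have hupper : ∀ ε ∈ Ioo (0 : ℝ) 1, ∀ᶠ p in smallErrors, H.ess 0 (χ p.1 p.2).1 ≤
      ENNReal.ofReal ((1 + ε) * (|Real.log p.2| / H.I 0)) := by
    intro ε ⟨h0, h1⟩
    -- The bound `a ≤ ε / 24` gives both `a ≤ 1 / 8` and `8 a ≤ ε / 3`; then `(1 + ε / 3) ^ 2 ≤ 1 +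
    -- ε`.
    filter_upwards [eventually_regime hK, hu,
      eventually_sizeSuffices hH hK hlog (by linarith : 0 < ε / 3),
      ha.eventually_le_const (by linarith : 0 < ε / 24)]
      with p ⟨g1, g2, g3⟩ hup ⟨B, c, hB, hS, hB'⟩ hap
    refine (hle _ g1 _ g2 B c hB hS (by linarith)).trans (ENNReal.ofReal_le_ofReal ?_)
    rw [← abs_log_eq g2] at hB'
    have ha0 := (rootLevel_mem g1 g3).1
    calc _ ≤ (1 + ε / 3) * (|Real.log p.2| / H.I 0) * (1 + ε / 3) := by
          gcongr
          linarith
      _ = (1 + ε / 3) * (1 + ε / 3) * (|Real.log p.2| / H.I 0) := by ring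
      _ ≤ _ := by
          refine mul_le_mul_of_nonneg_right ?_ hup.le
          nlinarith
  have hopt : ∀ᶠ p in smallErrors, H.optEss 0 p.1 p.2 ≤ H.ess 0 (χ p.1 p.2).1 := by
    filter_upwards [eventually_regime hK] with p ⟨g1, g2, _⟩
    exact iInf₂_le _ (hχ _ g1 _ g2)
  refine ⟨hχ, AsympEquiv.of_ofReal hu ?_ ?_⟩
  · refine asympEquiv_of_bounds hu fun ε hε => ?_
    filter_upwards [eventually_le_optEss_zero hH hε, hopt, hupper ε hε] with p h1 h2 h3
    exact ⟨h1.trans h2, h3⟩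
  · refine asympEquiv_of_bounds hu fun ε hε => ?_
    filter_upwards [eventually_le_optEss_zero hH hε, hopt, hupper ε hε] with p h1 h2 h3
    exact ⟨h1, h2.trans h3⟩

lemma asympEquiv_ess_one_ST (hH : H.Regular)
    (hK : ∀ α ∈ Ioo (0 : ℝ) 1, ∀ β ∈ Ioo (0 : ℝ) 1, 1 ≤ K α β)
    (ha : Tendsto (fun p : ℝ × ℝ => p.1 ^ (1 / (K p.1 p.2 : ℝ))) smallErrors (𝓝 0))
    (hlog : MuchLess smallErrors (fun p => |Real.log (p.1 ^ (1 / (K p.1 p.2 : ℝ)))|)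
      (fun p => |Real.log p.2|)) :
    AsympEquiv smallErrors (fun p => H.ess 1 (H.ST p.1 p.2 (K p.1 p.2)).1)
      (fun p => ENNReal.ofReal
        ((K p.1 p.2 : ℝ) * ((K p.1 p.2 : ℝ) + 1) / 2 * (|Real.log p.2| / H.I 0))) := by
  have hI := hH.I_pos
  have hu := eventually_pos_log_div hI
  have hv : ∀ᶠ p in smallErrors,
      0 < (K p.1 p.2 : ℝ) * ((K p.1 p.2 : ℝ) + 1) / 2 * (|Real.log p.2| / H.I 0) := by
    filter_upwards [eventually_regime hK, hu] with p ⟨_, _, g3⟩ hup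
    have : (0 : ℝ) < K p.1 p.2 := by exact_mod_cast g3
    positivity
  refine asympEquiv_of_bounds hv fun ε ⟨h0, h1⟩ => ?_
  obtain ⟨η, hη, hη1, h⟩ := exists_P_zero_le hH (ε := ε / 2) (by linarith) (by linarith)
  have h : H.ConverseAt (ε / 2) η := h
  filter_upwards [eventually_regime hK, hv, eventually_snd_mem hη,
    eventually_snd_mem (by linarith : 0 < ε / 2), eventually_sizeSuffices hH hK hlog h0,
    ha.eventually_lt_const (by linarith : 0 < 1 - ε / 2)]
    with p ⟨g1, g2, g3⟩ hvp hβη hβ ⟨B, c, hB, hS, hB'⟩ hap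
  constructor
  · refine le_trans (ENNReal.ofReal_le_ofReal ?_)
      (h.le_ess_one_ST hH (by linarith) g1 g3 hap g2 hβη.2)
    rw [abs_log_eq g2] at hvp ⊢
    rw [mul_right_comm]
    refine mul_le_mul_of_nonneg_right ?_ hvp.le
    nlinarith [hβ.1, hβ.2]
  · refine (hS.ess_one_ST_le hH g1 g2 g3 hB).trans (ENNReal.ofReal_le_ofReal ?_)
    rw [abs_log_eq g2, mul_left_comm]
    gcongr

lemma asympLE_ess_one_modST (hH : H.Regular) (hr : r ≤ 1)
    (hK : ∀ α ∈ Ioo (0 : ℝ) 1, ∀ β ∈ Ioo (0 : ℝ) 1, 1 ≤ K α β)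
    (hlog : MuchLess smallErrors (fun p => |Real.log (p.1 ^ (1 / (K p.1 p.2 : ℝ)))|)
      (fun p => |Real.log p.2|)) :
    AsympLE smallErrors (fun p => H.ess 1 (H.modST r p.1 p.2 (K p.1 p.2)).1)
      (fun p => ENNReal.ofReal ((K p.1 p.2 : ℝ) * (|Real.log p.2| / H.I 0))) := by
  refine asympLE_of_bounds fun ε ⟨h0, h1⟩ => ?_
  filter_upwards [eventually_regime hK, eventually_sizeSuffices hH hK hlog h0]
    with p ⟨g1, g2, g3⟩ ⟨B, c, hB, hS, hB'⟩
  refine (hS.ess_one_modST_le hr hH g1 g2 g3 hB).trans (ENNReal.ofReal_le_ofReal ?_)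
  rw [abs_log_eq g2, mul_left_comm]
  gcongr

lemma eventually_optEss_one_le (hH : H.Regular)
    (hK : ∀ α ∈ Ioo (0 : ℝ) 1, ∀ β ∈ Ioo (0 : ℝ) 1, 1 ≤ K α β)
    (hKL : MuchLess smallErrors (fun p => |Real.log p.1| / |Real.log p.2|)
      (fun p => (K p.1 p.2 : ℝ))) {ε : ℝ} (hε : 0 < ε) :
    ∀ᶠ p in smallErrors, H.optEss 1 p.1 p.2 ≤
      ENNReal.ofReal (ε * ((K p.1 p.2 : ℝ) * (|Real.log p.2| / H.I 0))) := by
  have hI := hH.I_pos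
  obtain ⟨C, hC, h⟩ := exists_optEss_one_le hH
  set κ := min 1 (ε / (5 * C * H.I 0)) with hκ
  have hκ0 : 0 < κ := by positivity
  -- With `x = K |log β|`, each of `1`, `|log α|` and `α |log β|` is at most `κ x`. The first two
  -- occur twice and the third once, hence the `5` in `κ`.
  filter_upwards [eventually_regime hK, hKL.eventually_lt_const hκ0, eventually_fst_mem hκ0,
    eventually_le_neg_log (1 / κ)] with p ⟨g1, g2, g3⟩ e1 e2 e3
  refine (h _ g1 _ g2).trans (ENNReal.ofReal_le_ofReal ?_)
  have hK1 : (1 : ℝ) ≤ K p.1 p.2 := by exact_mod_cast g3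
  have hL : 0 < -Real.log p.2 := neg_pos.2 (Real.log_neg g2.1 g2.2)
  have hLα : 0 < -Real.log p.1 := neg_pos.2 (Real.log_neg g1.1 g1.2)
  rw [abs_log_eq g1, abs_log_eq g2, div_div, div_lt_iff₀ (by positivity), mul_comm (-Real.log p.2)]
    at e1
  rw [abs_log_eq g2]
  set x := (K p.1 p.2 : ℝ) * -Real.log p.2 with hx
  have hLx : -Real.log p.2 ≤ x := le_mul_of_one_le_left hL.le hK1
  have hone : 1 ≤ κ * x := by
    rw [div_le_iff₀ hκ0] at e3
    nlinarith
  have hα1 : p.1 * (1 + -Real.log p.1 + -Real.log p.2) ≤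
      (1 + -Real.log p.1) + κ * x := by
    nlinarith [e2.1, e2.2, g1.2]
  have hfin : 5 * C * H.I 0 * κ ≤ ε := by
    have := min_le_right 1 (ε / (5 * C * H.I 0))
    rw [← hκ, le_div_iff₀ (by positivity)] at this
    linarith
  have hx0 : 0 < x := by positivity
  rw [← mul_div_assoc, ← hx, ← mul_div_assoc, le_div_iff₀ hI]
  calc _ = C * ((1 + -Real.log p.1) + p.1 * (1 + -Real.log p.1 + -Real.log p.2)) * H.I 0 := by ring
    _ ≤ C * (5 * (κ * x)) * H.I 0 := by
        gcongr
        linarith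
    _ = 5 * C * H.I 0 * κ * x := by ring
    _ ≤ ε * x := by gcongr

end SimpleTesting

/-- `K α β` is the maximum number of stages, as a function of the error levels. The number `r` is
the least size allowed for the stages of mod-ST after the first (positive or nonnegative
integers). -/
theorem mainTheorem4 {S : Type*} [MeasurableSpace S] (H : SimpleTesting S)
    (hI0 : 0 < H.kl 0 ∧ H.kl 0 < ∞) (hI1 : 0 < H.kl 1 ∧ H.kl 1 < ∞)
    (r : ℕ) (hr : r = 0 ∨ r = 1)
    (K : ℝ → ℝ → ℕ) (hK : ∀ α ∈ Ioo (0 : ℝ) 1, ∀ β ∈ Ioo (0 : ℝ) 1, 1 ≤ K α β) :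
    -- the two forms of the condition on `K` are equivalent
    ((Tendsto (fun p : ℝ × ℝ => p.1 ^ (1 / (K p.1 p.2 : ℝ))) smallErrors (𝓝 0) ∧
        MuchLess smallErrors (fun p => |Real.log (p.1 ^ (1 / (K p.1 p.2 : ℝ)))|)
          (fun p => |Real.log p.2|)) ↔
      (MuchLess smallErrors (fun p => |Real.log p.1| / |Real.log p.2|)
          (fun p => (K p.1 p.2 : ℝ)) ∧
        MuchLess smallErrors (fun p => (K p.1 p.2 : ℝ)) (fun p => |Real.log p.1|))) ∧
    -- the results under this condition
    (MuchLess smallErrors (fun p => |Real.log p.1| / |Real.log p.2|)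
        (fun p => (K p.1 p.2 : ℝ)) →
      MuchLess smallErrors (fun p => (K p.1 p.2 : ℝ)) (fun p => |Real.log p.1|) →
      H.AsympOptimalNull (fun α β => H.ST α β (K α β)) ∧
      H.AsympOptimalNull (fun α β => H.modST r α β (K α β)) ∧
      AsympEquiv smallErrors
        (fun p => H.ess 1 (H.ST p.1 p.2 (K p.1 p.2)).1)
        (fun p => ENNReal.ofReal
          ((K p.1 p.2 : ℝ) * ((K p.1 p.2 : ℝ) + 1) / 2 * (|Real.log p.2| / H.I 0))) ∧
      MuchGreater smallErrors
        (fun p => ENNReal.ofReal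
          ((K p.1 p.2 : ℝ) * ((K p.1 p.2 : ℝ) + 1) / 2 * (|Real.log p.2| / H.I 0)))
        (fun p => ENNReal.ofReal (((K p.1 p.2 : ℝ) + 1) / 2) * H.optEss 1 p.1 p.2) ∧
      AsympLE smallErrors
        (fun p => H.ess 1 (H.modST r p.1 p.2 (K p.1 p.2)).1)
        (fun p => ENNReal.ofReal ((K p.1 p.2 : ℝ) * (|Real.log p.2| / H.I 0))) ∧
      AsympEquiv smallErrors
        (fun p => ENNReal.ofReal ((K p.1 p.2 : ℝ) * (|Real.log p.2| / H.I 0)))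
        (fun p => ENNReal.ofReal (2 / ((K p.1 p.2 : ℝ) + 1)) *
          H.ess 1 (H.ST p.1 p.2 (K p.1 p.2)).1)) := by
  have hH := SimpleTesting.regular_of_kl hI0 hI1.2
  have hr' : r ≤ 1 := by omega
  refine ⟨(and_congr (SimpleTesting.tendsto_rootLevel_iff hK) (SimpleTesting.muchLess_log_rootLevel_iff hK)).trans and_comm,
    fun hKL hKα => ?_⟩
  have ha := (SimpleTesting.tendsto_rootLevel_iff hK).2 hKα
  have hlog := (SimpleTesting.muchLess_log_rootLevel_iff hK).2 hKL
  have hu : ∀ᶠ p in smallErrors, 0 < (K p.1 p.2 : ℝ) * (|Real.log p.2| / H.I 0) := by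
    filter_upwards [SimpleTesting.eventually_regime hK, SimpleTesting.eventually_pos_log_div hH.I_pos] with p ⟨_, _, h⟩ hu
    exact mul_pos (by exact_mod_cast h) hu
  have hv : ∀ᶠ p in smallErrors, 0 < ((K p.1 p.2 : ℝ) + 1) / 2 := .of_forall fun p => by positivity
  have hmul (p : ℝ × ℝ) :
      (K p.1 p.2 : ℝ) * ((K p.1 p.2 : ℝ) + 1) / 2 * (|Real.log p.2| / H.I 0) =
        ((K p.1 p.2 : ℝ) + 1) / 2 * ((K p.1 p.2 : ℝ) * (|Real.log p.2| / H.I 0)) := by ring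
  have hST := SimpleTesting.asympEquiv_ess_one_ST hH hK ha hlog
  refine ⟨?_, ?_, hST, ?_, SimpleTesting.asympLE_ess_one_modST hH hr' hK hlog, ?_⟩
  · exact SimpleTesting.asympOptimalNull_of_sizeSuffices hH hK ha hlog
      (fun α hα β hβ => SimpleTesting.ST_mem_testClass hH hα hβ (hK α hα β hβ))
      fun α hα β hβ B c hB hS h => hS.ess_zero_ST_le hH hα hβ (hK α hα β hβ) hB h
  · exact SimpleTesting.asympOptimalNull_of_sizeSuffices hH hK ha hlog
      (fun α hα β hβ => SimpleTesting.modST_mem_testClass hH r hα hβ (hK α hα β hβ))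
      fun α hα β hβ B c hB hS h => hS.ess_zero_modST_le hr' hH hα hβ (hK α hα β hβ) hB h
  · simp only [hmul]
    exact muchGreater_of_bounds hu hv fun ε hε => SimpleTesting.eventually_optEss_one_le hH hK hKL hε
  · have hw : ∀ᶠ p in smallErrors, 0 <
        (K p.1 p.2 : ℝ) * ((K p.1 p.2 : ℝ) + 1) / 2 * (|Real.log p.2| / H.I 0) := by
      filter_upwards [hu, hv] with p h1 h2
      rw [hmul]
      exact mul_pos h2 h1
    refine (hST.symm_ofReal hw).congr fun p => ?_
    have hc : (0 : ℝ) < 2 / ((K p.1 p.2 : ℝ) + 1) := by positivity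
    have hsplit : (K p.1 p.2 : ℝ) * (|Real.log p.2| / H.I 0) = 2 / ((K p.1 p.2 : ℝ) + 1) *
        ((K p.1 p.2 : ℝ) * ((K p.1 p.2 : ℝ) + 1) / 2 * (|Real.log p.2| / H.I 0)) := by
      field_simp
    beta_reduce
    rw [hsplit, ENNReal.ofReal_mul hc.le, ENNReal.mul_div_mul_left _ _ (by simpa using hc)
      ENNReal.ofReal_ne_top]
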